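/- Let $\mathcal F$ be the class of functions $f:\mathbb R\to\mathbb R\cup\{\infty\}$ such that: (1) $f(0)=0$ and $f$ is right continuous at $0$; (2) $f$ is finite and differentiable on $(0,\infty)$ with $f'>0$ there, there are $a_1>0$ and $a_2$ with $f'(x)\ge a_1$ for all $x>0$ with $x>a_2$, and there are $1<q<2$ and $a_3>0$ with $\liminf_{x\searrow 0} f'(x)^q/f(x)\ge a_3$; (3) either $f(x)=\infty$ for all $x<0$, or $f(x)=f(-x)$ for all $x$. Write $R_n(\mathbf x)=\sum_{i=1}^n f(x_i)$, $\mathcal S_n(t)=\{\mathbf x\in\mathbb R^n: R_n(\mathbf x)=nt\}$, let $\sigma_{n,t}$ be the induced Riemannian volume ($(n-1)$-dimensional Hausdorff measure) on $\mathcal S_n(t)$, and for $c>0$ let $g_{n,c}(\mathbf x)=e^{-cR_n(\mathbf x)}/Z_c^n$, $Z_c=\int e^{-cf(x)}\,dx$, be the Gibbs density on $\mathbb R^n$. Let $S_{n,t}(\mathbf x)=\kappa\mathbf x$, where $\kappa>0$ is such that $R_n(\kappa\mathbf x)=nt$, let $A_{n,t}(r,\mathbf s)$ be the Jacobian of the change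 of coordinates $\mathbf x\leftrightarrow(r,\mathbf s)=(R_n(\mathbf x),S_{n,t}(\mathbf x))$, so that $d\mathbf x=A_{n,t}(r,\mathbf s)\,dr\,\sigma_{n,t}(d\mathbf s)$, and let $h_{n,t}$ be the probability law on $\mathcal S_n(t)$ with density $\mathbf v\mapsto A_{n,t}(nt,\mathbf v)\big/\int A_{n,t}(nt,\mathbf s)\,\sigma_{n,t}(d\mathbf s)$ with respect to $\sigma_{n,t}$. For $k\le n$ let $p_{n,k,t}$ be the law of the first $k$ coordinates of a point with law $h_{n,t}$. **Proposition.** Let $f\in\mathcal F$, $t>0$, and let $c>0$ satisfy $\int g_{1,c}(x)f(x)\,dx=t$. Let $n\to\infty$ along any sequence, and let $k=k(n)\le n$. If the total variation distance between $p_{n,k,t}$ and the law with density $g_{k,c}$ tends to $0$, then $k/n\to0$. Likewise, if the relative entropy $D(p_{n,k,t}\,\|\,g_{k,c})$ tends to $0$, then $k/n\to0$. -/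

import Mathlib

open MeasureTheory Filter Topology
open scoped ENNReal

noncomputable section

namespace GibbsSurface

/-- `ℝⁿ` with its Euclidean structure and Lebesgue measure. -/
abbrev E (n : ℕ) : Type := EuclideanSpace ℝ (Fin n)

/-- The class `𝓕` of functions `f : ℝ → ℝ ∪ {∞}`; `ℝ ∪ {∞}` is `EReal` without `⊥`, and
derivatives at `x > 0`, where `f` is finite, are those of the real-valued `x ↦ (f x).toReal`.
The lower limit is taken in `EReal` because the quotient may tend to `+∞`. -/
structure ClassF (f : ℝ → EReal) : Prop where
  ne_bot : ∀ x, f x ≠ ⊥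
  map_zero : f 0 = 0
  right_cont : ContinuousWithinAt f (Set.Ici 0) 0
  finite_pos : ∀ x, 0 < x → f x ≠ ⊤
  diff : ∀ x, 0 < x → DifferentiableAt ℝ (fun y => (f y).toReal) x
  deriv_pos : ∀ x, 0 < x → 0 < deriv (fun y => (f y).toReal) x
  tail : ∃ a₁ a₂ : ℝ, 0 < a₁ ∧ ∀ x, 0 < x → a₂ < x → a₁ ≤ deriv (fun y => (f y).toReal) x
  near_zero : ∃ q a₃ : ℝ, 1 < q ∧ q < 2 ∧ 0 < a₃ ∧
    (a₃ : EReal) ≤ liminf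
      (fun x => ((deriv (fun y => (f y).toReal) x ^ q / (f x).toReal : ℝ) : EReal)) (𝓝[>] (0 : ℝ))
  side : (∀ x, x < 0 → f x = ⊤) ∨ (∀ x, f x = f (-x))

/-- `R_n(x) = f(x_1) + ⋯ + f(x_n)`. -/
def R (f : ℝ → EReal) (n : ℕ) (x : E n) : EReal := ∑ i, f (x i)

/-- The surface `S_n(t) = {x : R_n(x) = nt}`. -/
def surface (f : ℝ → EReal) (n : ℕ) (t : ℝ) : Set (E n) :=
  {x | R f n x = ((n * t : ℝ) : EReal)}

/-- The partition function `Z_c = ∫ exp(-c f(x)) dx`, with `exp(-∞) = 0`. -/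
def Z (f : ℝ → EReal) (c : ℝ) : ℝ≥0∞ := ∫⁻ x : ℝ, EReal.exp (-((c : EReal) * f x))

/-- The Gibbs density `g_{n,c}(x) = exp(-c R_n(x)) / Z_c ^ n`. -/
def gibbsDensity (f : ℝ → EReal) (c : ℝ) (n : ℕ) (x : E n) : ℝ≥0∞ :=
  EReal.exp (-((c : EReal) * R f n x)) / Z f c ^ n

/-- The law with density `g_{n,c}`. -/
def gibbs (f : ℝ → EReal) (c : ℝ) (n : ℕ) : Measure (E n) :=
  volume.withDensity (gibbsDensity f c n)

/-- The energy `∫ q(x) R_n(x) dx` of a density `q` that vanishes where `R_n` is infinite. -/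
def energy (f : ℝ → EReal) (n : ℕ) (q : E n → ℝ≥0∞) : ℝ :=
  ∫ x, (q x).toReal * (R f n x).toReal

/-- The central projection onto `S_n(t)`: `x ↦ κ x`, where `κ > 0` is the (unique, for `f ∈ 𝓕`,
`t > 0` and `x ∈ Fⁿ \ {0}`) scalar with `R_n(κ x) = nt`. -/
def centralProj (f : ℝ → EReal) (n : ℕ) (t : ℝ) (x : E n) : E n :=
  sInf {κ : ℝ | 0 < κ ∧ κ • x ∈ surface f n t} • x

/-- The coordinates `x ↦ (R_n(x), S_{n,t}(x))` attached to the foliation by the surfaces;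
the target is the Euclidean product of `ℝ` and `ℝⁿ`. -/
def coords (f : ℝ → EReal) (n : ℕ) (t : ℝ) (x : E n) : WithLp 2 (ℝ × E n) :=
  WithLp.toLp 2 ((R f n x).toReal, centralProj f n t x)

/-- The Jacobian `A_{n,t}` at the point `x`, i.e. the factor in `dx = A_{n,t} dr σ_{n,t}(ds)` for
`(r, s) = (R_n(x), S_{n,t}(x))`: the reciprocal of the `n`-dimensional volume factor
`√(det (DᵀD))` of the derivative `D` of the coordinate map. -/
def jacobianA (f : ℝ → EReal) (n : ℕ) (t : ℝ) (x : E n) : ℝ :=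
  ((fderiv ℝ (coords f n t) x).toLinearMap.normDet)⁻¹

/-- The Riemannian volume `σ_{n,t}` of `S_n(t)`: `(n-1)`-dimensional Hausdorff measure, in the
Euclidean normalization, restricted to the surface. -/
def surfaceVolume (f : ℝ → EReal) (n : ℕ) (t : ℝ) : Measure (E n) :=
  (Measure.euclideanHausdorffMeasure (n - 1) : Measure (E n)).restrict (surface f n t)

/-- The density `h_{n,t}(v) = A_{n,t}(nt, v) / ∫ A_{n,t}(nt, s) σ_{n,t}(ds)` with respect to
`σ_{n,t}`; a point `v` of `S_n(t)` has coordinates `(nt, v)`. -/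
def hDensity (f : ℝ → EReal) (n : ℕ) (t : ℝ) (v : E n) : ℝ≥0∞ :=
  ENNReal.ofReal (jacobianA f n t v) /
    ∫⁻ s, ENNReal.ofReal (jacobianA f n t s) ∂(surfaceVolume f n t)

/-- The law on `S_n(t)` with density `h_{n,t}`. -/
def hLaw (f : ℝ → EReal) (n : ℕ) (t : ℝ) : Measure (E n) :=
  (surfaceVolume f n t).withDensity (hDensity f n t)

/-- The projection `π_{n,k}` to the first `k` coordinates. -/
def proj {n k : ℕ} (hkn : k ≤ n) (x : E n) : E k :=
  WithLp.toLp 2 (fun i => x (Fin.castLE hkn i))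

/-- `p_{n,k,t}`: the law of the first `k` coordinates under `h_{n,t}`. -/
def projLaw (f : ℝ → EReal) (t : ℝ) {n k : ℕ} (hkn : k ≤ n) : Measure (E k) :=
  (hLaw f n t).map (proj hkn)

/-- Total variation distance of probability measures, normalized so that it equals `∫ |u - v|`
for measures with densities `u` and `v`. -/
def tvDist {Ω : Type*} [MeasurableSpace Ω] (μ ν : Measure Ω) : ℝ≥0∞ :=
  2 * ⨆ (s : Set Ω) (_ : MeasurableSet s), ENNReal.ofReal |μ.real s - ν.real s|

end GibbsSurface

end

/-! The constraint `R_n = nt` says that the centered energies `f(x_i) - t` sum to zero, and this is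
incompatible with near independence of a positive proportion of the coordinates. Suppose `k ≥ εn`
and `p_{n,k,t}` is close to the Gibbs law. Cut the `n` indices into a bounded number `M` of blocks
of length at most `ℓ = k/2`, and let `B r` be the sum of centered energies over block `r`, divided
by `√n`. The law `h_{n,t}` is exchangeable, so closeness for the first `k` coordinates gives
closeness for any two blocks jointly, and under the Gibbs law two blocks are independent and
centered. Since `∑ r, B r = 0`, the second moment of a full block `B r₀` equals minus the sum of its
covariances with the others, hence is nearly zero; but closeness also forces it to be near its Gibbs
value `ℓv/n`, which is bounded below by a multiple of `εv`.

Total variation controls only bounded functions, so all moments are truncated at a level `K`; fourth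
moments of block sums, of order `card²` under the product law, make the truncation errors uniformly
small in `n`. The estimate is `ClassF.block_variance_le`, resting on `integral_clamp_sq_le` and
`ClassF.exists_blocks`; `ClassF.exists_separation` chooses the constants. Relative entropy reduces
to uniform closeness on sets by a weak Pinsker inequality. -/

namespace GibbsSurface

/-! ### Truncation and sums of independent variables -/

open ProbabilityTheory

/-- Truncation of a real number to `[-K, K]`. -/
noncomputable def clamp (K x : ℝ) : ℝ := max (-K) (min K x)

lemma measurable_clamp (K : ℝ) : Measurable (clamp K) := by
  unfold clamp
  fun_prop

lemma abs_clamp_le {K : ℝ} (hK : 0 ≤ K) (x : ℝ) : |clamp K x| ≤ K := by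
  unfold clamp
  rw [abs_le]
  exact ⟨le_max_left _ _, max_le (by linarith) (min_le_left _ _)⟩

lemma clamp_eq_self {K x : ℝ} (h : |x| ≤ K) : clamp K x = x := by
  unfold clamp
  rw [abs_le] at h
  rw [min_eq_right h.2, max_eq_right h.1]

lemma abs_clamp_le_abs {K : ℝ} (hK : 0 ≤ K) (x : ℝ) : |clamp K x| ≤ |x| := by
  by_cases h : |x| ≤ K
  · rw [clamp_eq_self h]
  · exact (abs_clamp_le hK x).trans (not_le.1 h).le

/-- The error vanishes on `[-K, K]` and is at most `|x|` elsewhere, where `(|x| / K) ^ 3 ≥ 1`. Thus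
a fourth moment controls the effect of truncation on the mean. -/
lemma abs_sub_clamp_le {K : ℝ} (hK : 0 < K) (x : ℝ) : |x - clamp K x| ≤ x ^ 4 / K ^ 3 := by
  by_cases h : |x| ≤ K
  · rw [clamp_eq_self h]
    simp only [sub_self, abs_zero]
    positivity
  · push Not at h
    have h1 : |x - clamp K x| ≤ |x| := by
      unfold clamp
      rcases le_total 0 x with hx | hx
      · rw [abs_of_nonneg hx] at h ⊢
        rw [min_eq_left h.le, max_eq_right (by linarith), abs_of_nonneg] <;> linarith
      · rw [abs_of_nonpos hx] at h ⊢
        rw [min_eq_right (by linarith), max_eq_left (by linarith), abs_of_nonpos] <;> linarith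
    refine h1.trans ?_
    rw [le_div_iff₀ (by positivity)]
    have h4 : x ^ 4 = |x| * |x| ^ 3 := by
      rw [← pow_succ', (show Even 4 by decide).pow_abs]
    rw [h4]
    gcongr

lemma sq_sub_le_clamp_sq {K : ℝ} (hK : 0 < K) (x : ℝ) : x ^ 2 - x ^ 4 / K ^ 2 ≤ clamp K x ^ 2 := by
  by_cases h : |x| ≤ K
  · rw [clamp_eq_self h]
    have : 0 ≤ x ^ 4 / K ^ 2 := by positivity
    linarith
  · push Not at h
    have h2 : K ^ 2 ≤ x ^ 2 := by
      rw [← sq_abs x]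
      gcongr
    have : x ^ 2 ≤ x ^ 4 / K ^ 2 := by
      rw [le_div_iff₀ (by positivity)]
      nlinarith [sq_nonneg x]
    nlinarith [sq_nonneg (clamp K x)]

variable {Ω : Type*} [MeasurableSpace Ω]

lemma integrable_pow_of_pow_four {μ : Measure Ω} [IsFiniteMeasure μ] {S : Ω → ℝ}
    (hS : Measurable S) (h4 : Integrable (fun ω => S ω ^ 4) μ) {j : ℕ} (hj : j ≤ 4) :
    Integrable (fun ω => S ω ^ j) μ := by
  refine ((integrable_const (1 : ℝ)).add h4).mono' (hS.pow_const j).aestronglyMeasurable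
    (Eventually.of_forall fun ω => ?_)
  have h0 : 0 ≤ |S ω| := abs_nonneg _
  have h : S ω ^ 4 = |S ω| ^ 4 := ((show Even 4 by decide).pow_abs _).symm
  rw [Real.norm_eq_abs, abs_pow, Pi.add_apply, h]
  rcases le_total |S ω| 1 with h1 | h1
  · exact (pow_le_one₀ h0 h1).trans (le_add_of_nonneg_right (by positivity))
  · exact (pow_le_pow_right₀ h1 hj).trans (by linarith)

/-- Moments up to order four of a sum of centered independent variables. -/
lemma moments_sum_of_iIndepFun {ι : Type*} {μ : Measure Ω} [IsProbabilityMeasure μ]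
    {X : ι → Ω → ℝ} (hX : ∀ i, Measurable (X i)) (hind : iIndepFun X μ)
    {v m : ℝ} (h4 : ∀ i, Integrable (fun ω => X i ω ^ 4) μ) (hm1 : ∀ i, ∫ ω, X i ω ∂μ = 0)
    (hm2 : ∀ i, ∫ ω, X i ω ^ 2 ∂μ = v) (hm4 : ∀ i, ∫ ω, X i ω ^ 4 ∂μ = m) (A : Finset ι) :
    Integrable (fun ω => (∑ i ∈ A, X i ω) ^ 4) μ ∧ ∫ ω, ∑ i ∈ A, X i ω ∂μ = 0 ∧
      ∫ ω, (∑ i ∈ A, X i ω) ^ 2 ∂μ = A.card * v ∧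
      ∫ ω, (∑ i ∈ A, X i ω) ^ 4 ∂μ ≤ 3 * A.card ^ 2 * v ^ 2 + A.card * m := by
  classical
  induction A using Finset.induction_on with
  | empty => simp
  | insert a A ha ih =>
    obtain ⟨i4, i1, i2, i4'⟩ := ih
    have hSm : Measurable (fun ω => ∑ i ∈ A, X i ω) := Finset.measurable_fun_sum _ fun i _ => hX i
    have hi : IndepFun (fun ω => ∑ i ∈ A, X i ω) (X a) μ := by
      have := hind.indepFun_finsetSum_of_notMem hX ha
      rwa [Finset.sum_fn] at this
    set S : Ω → ℝ := fun ω => ∑ i ∈ A, X i ω with hSdef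
    have hSi : ∀ j, j ≤ 4 → Integrable (fun ω => S ω ^ j) μ := fun j hj =>
      integrable_pow_of_pow_four hSm i4 hj
    have hXi : ∀ j, j ≤ 4 → Integrable (fun ω => X a ω ^ j) μ := fun j hj =>
      integrable_pow_of_pow_four (hX a) (h4 a) hj
    -- Independence gives both the integrability and the factorization of every mixed moment.
    have hprod : ∀ p q, p ≤ 4 → q ≤ 4 → Integrable (fun ω => S ω ^ p * X a ω ^ q) μ ∧
        ∫ ω, S ω ^ p * X a ω ^ q ∂μ = (∫ ω, S ω ^ p ∂μ) * ∫ ω, X a ω ^ q ∂μ := fun p q hp hq => by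
      have hc : IndepFun (fun ω => S ω ^ p) (fun ω => X a ω ^ q) μ :=
        hi.comp (φ := fun x : ℝ => x ^ p) (ψ := fun x : ℝ => x ^ q) (by fun_prop) (by fun_prop)
      exact ⟨hc.integrable_mul (hSi p hp) (hXi q hq), hc.integral_fun_mul_eq_mul_integral
        (hSi p hp).aestronglyMeasurable (hXi q hq).aestronglyMeasurable⟩
    have hsum : ∀ ω, ∑ i ∈ insert a A, X i ω = S ω + X a ω := fun ω => by
      rw [Finset.sum_insert ha, add_comm]
    have hexp4 : ∀ ω, (S ω + X a ω) ^ 4 = S ω ^ 4 * X a ω ^ 0 + (4 * (S ω ^ 3 * X a ω ^ 1) +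
        (6 * (S ω ^ 2 * X a ω ^ 2) + (4 * (S ω ^ 1 * X a ω ^ 3) + S ω ^ 0 * X a ω ^ 4))) :=
      fun ω => by ring
    have hexp2 : ∀ ω, (S ω + X a ω) ^ 2 = S ω ^ 2 * X a ω ^ 0 + (2 * (S ω ^ 1 * X a ω ^ 1) +
        S ω ^ 0 * X a ω ^ 2) := fun ω => by ring
    have e40 := hprod 4 0 (by norm_num) (by norm_num)
    have e31 := hprod 3 1 (by norm_num) (by norm_num)
    have e22 := hprod 2 2 (by norm_num) (by norm_num)
    have e13 := hprod 1 3 (by norm_num) (by norm_num)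
    have e04 := hprod 0 4 (by norm_num) (by norm_num)
    have e20 := hprod 2 0 (by norm_num) (by norm_num)
    have e11 := hprod 1 1 (by norm_num) (by norm_num)
    have e02 := hprod 0 2 (by norm_num) (by norm_num)
    have hX1 : ∫ ω, X a ω ^ 1 ∂μ = 0 := by simpa using hm1 a
    have hS1 : ∫ ω, S ω ^ 1 ∂μ = 0 := by simpa using i1
    have c13 := e13.1.const_mul 4
    have c22 := e22.1.const_mul 6
    have c31 := e31.1.const_mul 4
    have c11 := e11.1.const_mul 2
    have d13 : Integrable (fun ω => 4 * (S ω ^ 1 * X a ω ^ 3) + S ω ^ 0 * X a ω ^ 4) μ :=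
      c13.add e04.1
    have d22 : Integrable (fun ω => 6 * (S ω ^ 2 * X a ω ^ 2) +
        (4 * (S ω ^ 1 * X a ω ^ 3) + S ω ^ 0 * X a ω ^ 4)) μ := c22.add d13
    have d31 : Integrable (fun ω => 4 * (S ω ^ 3 * X a ω ^ 1) + (6 * (S ω ^ 2 * X a ω ^ 2) +
        (4 * (S ω ^ 1 * X a ω ^ 3) + S ω ^ 0 * X a ω ^ 4))) μ := c31.add d22
    have d11 : Integrable (fun ω => 2 * (S ω ^ 1 * X a ω ^ 1) + S ω ^ 0 * X a ω ^ 2) μ :=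
      c11.add e02.1
    simp only [hsum, Finset.card_insert_of_notMem ha]
    refine ⟨?_, ?_, ?_, ?_⟩
    · simp only [hexp4]
      exact e40.1.add d31
    · rw [integral_add (by simpa using hSi 1 (by norm_num)) (by simpa using hXi 1 (by norm_num)),
        i1, hm1, add_zero]
    · simp only [hexp2]
      rw [integral_add e20.1 d11, integral_add c11 e02.1, integral_const_mul,
        e20.2, e11.2, e02.2, hX1, hm2, i2]
      simp only [pow_zero, integral_const, probReal_univ, smul_eq_mul]
      push_cast
      ring
    · simp only [hexp4]
      rw [integral_add e40.1 d31, integral_add c31 d22, integral_add c22 d13,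
        integral_add c13 e04.1, integral_const_mul, integral_const_mul, integral_const_mul,
        e40.2, e31.2, e22.2, e13.2, e04.2, hX1, hS1, hm2, hm4, i2]
      simp only [pow_zero, integral_const, probReal_univ, smul_eq_mul]
      push_cast
      -- Terms containing a first moment vanish; what remains closes because `3N² + 6N ≤ 3(N + 1)²`.
      nlinarith [sq_nonneg v]

/-- Disjoint block sums of independent variables are independent. -/
lemma indepFun_sum_of_disjoint {ι : Type*} {μ : Measure Ω} {X : ι → Ω → ℝ}
    (hX : ∀ i, Measurable (X i)) (hind : iIndepFun X μ) {A B : Finset ι} (hAB : Disjoint A B) :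
    IndepFun (fun ω => ∑ i ∈ A, X i ω) (fun ω => ∑ i ∈ B, X i ω) μ := by
  have h := (hind.indepFun_finset A B hAB hX).comp
    (φ := fun y : A → ℝ => ∑ i, y i) (ψ := fun y : B → ℝ => ∑ i, y i)
    (by fun_prop) (by fun_prop)
  convert h using 1
  · ext ω
    exact (Finset.sum_coe_sort A fun i => X i ω).symm
  · ext ω
    exact (Finset.sum_coe_sort B fun i => X i ω).symm

/-- If variables have vanishing sum, small tails and small truncated covariances with one of
them, then the truncated second moment of that one is small. -/
lemma integral_clamp_sq_le {ι : Type*} [Fintype ι] {P : Measure Ω} [IsProbabilityMeasure P]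
    {B : ι → Ω → ℝ} (hB : ∀ r, Measurable (B r)) (hsum : ∀ᵐ ω ∂P, ∑ r, B r ω = 0)
    {K η θ : ℝ} (hK : 0 ≤ K) (i : ι) (htail : ∀ r, P.real {ω | K < |B r ω|} ≤ η)
    (hθ : 0 ≤ θ) (hcross : ∀ r, r ≠ i → |∫ ω, clamp K (B i ω) * clamp K (B r ω) ∂P| ≤ θ) :
    ∫ ω, clamp K (B i ω) ^ 2 ∂P ≤
      Fintype.card ι * θ + Fintype.card ι ^ 2 * K ^ 2 * η := by
  classical
  have hm : ∀ r, Measurable (fun ω => clamp K (B r ω)) := fun r => (measurable_clamp K).comp (hB r)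
  have hmul : ∀ r ω, |clamp K (B i ω) * clamp K (B r ω)| ≤ K ^ 2 := fun r ω => by
    rw [abs_mul, sq]
    exact mul_le_mul (abs_clamp_le hK _) (abs_clamp_le hK _) (abs_nonneg _) hK
  have hint : ∀ r, Integrable (fun ω => clamp K (B i ω) * clamp K (B r ω)) P := fun r =>
    (integrable_const (K ^ 2)).mono' ((hm i).mul (hm r)).aestronglyMeasurable
      (Eventually.of_forall (hmul r))
  have hmeas : ∀ r, MeasurableSet {ω | K < |B r ω|} := fun r =>
    measurableSet_lt measurable_const (by have := hB r; fun_prop)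
  have hindint : ∀ r, Integrable (Set.indicator {ω | K < |B r ω|} (fun _ => (1 : ℝ))) P := fun r =>
    (integrable_const (1 : ℝ)).indicator (hmeas r)
  -- Either some `|B r|` exceeds `K` and the indicators pay for the trivial bound, or no truncation
  -- acts and the sum is a multiple of `∑ r, B r = 0`.
  have hle : ∀ᵐ ω ∂P, ∑ r, clamp K (B i ω) * clamp K (B r ω) ≤
      Fintype.card ι * K ^ 2 * ∑ r, Set.indicator {ω | K < |B r ω|} (fun _ => (1 : ℝ)) ω := by
    filter_upwards [hsum] with ω hω
    by_cases h : ∃ r, K < |B r ω|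
    · obtain ⟨r, hr⟩ := h
      have h1 : (1 : ℝ) ≤ ∑ r, Set.indicator {ω | K < |B r ω|} (fun _ => (1 : ℝ)) ω := by
        have h2 : Set.indicator {ω | K < |B r ω|} (fun _ => (1 : ℝ)) ω = 1 :=
          Set.indicator_of_mem (s := {ω | K < |B r ω|}) hr _
        exact h2.ge.trans <| Finset.single_le_sum
          (f := fun r => Set.indicator {ω | K < |B r ω|} (fun _ => (1 : ℝ)) ω)
          (fun r _ => Set.indicator_nonneg (fun _ _ => zero_le_one) ω) (Finset.mem_univ r)
      calc ∑ r, clamp K (B i ω) * clamp K (B r ω) ≤ ∑ _r : ι, K ^ 2 :=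
            Finset.sum_le_sum fun r _ => (abs_le.1 (hmul r ω)).2
        _ = Fintype.card ι * K ^ 2 * 1 := by simp
        _ ≤ _ := by gcongr
    · push Not at h
      rw [← Finset.mul_sum, Finset.sum_congr rfl fun r _ => clamp_eq_self (h r), hω, mul_zero]
      exact mul_nonneg (by positivity) (Finset.sum_nonneg fun r _ =>
        Set.indicator_nonneg (fun _ _ => zero_le_one) ω)
  have h1 := integral_mono_ae (integrable_finsetSum _ fun r _ => hint r)
    ((integrable_finsetSum _ fun r _ => hindint r).const_mul _) hle
  rw [integral_finsetSum _ fun r _ => hint r, integral_const_mul,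
    integral_finsetSum _ fun r _ => hindint r] at h1
  simp only [integral_indicator_const _ (hmeas _), smul_eq_mul, mul_one] at h1
  have h2 : ∑ r, P.real {ω | K < |B r ω|} ≤ Fintype.card ι * η :=
    (Finset.sum_le_sum fun r _ => htail r).trans (by simp)
  -- The diagonal term is the wanted second moment; each other term is at least `-θ`.
  rw [← Finset.add_sum_erase _ _ (Finset.mem_univ i)] at h1
  have h3 : -(Fintype.card ι * θ) ≤
      ∑ r ∈ Finset.univ.erase i, ∫ ω, clamp K (B i ω) * clamp K (B r ω) ∂P := by
    have h4 : ∑ _r ∈ Finset.univ.erase i, (-θ) ≤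
        ∑ r ∈ Finset.univ.erase i, ∫ ω, clamp K (B i ω) * clamp K (B r ω) ∂P :=
      Finset.sum_le_sum fun r hr => (abs_le.1 (hcross r (Finset.ne_of_mem_erase hr))).1
    refine le_trans ?_ h4
    rw [Finset.sum_const, nsmul_eq_mul, mul_neg, neg_le_neg_iff]
    gcongr
    exact Finset.card_le_univ _
  have h5 : (Fintype.card ι : ℝ) * K ^ 2 * ∑ r, P.real {ω | K < |B r ω|} ≤
      Fintype.card ι * K ^ 2 * (Fintype.card ι * η) := by gcongr
  simp only [sq (clamp K _)]
  nlinarith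

/-! ### Comparison of probability measures -/

/-- Measures that are uniformly close on sets have close integrals of bounded functions. -/
lemma abs_integral_sub_le {p g : Measure Ω} [IsProbabilityMeasure p] [IsProbabilityMeasure g]
    {δ : ℝ} (hd : ∀ s, MeasurableSet s → |p.real s - g.real s| ≤ δ) {ψ : Ω → ℝ}
    (hψ : Measurable ψ) {L : ℝ} (hL : ∀ ω, |ψ ω| ≤ L) :
    |∫ ω, ψ ω ∂p - ∫ ω, ψ ω ∂g| ≤ 2 * L * δ := by
  have hint : ∀ (μ : Measure Ω) [IsProbabilityMeasure μ], Integrable ψ μ := fun μ _ =>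
    (integrable_const L).mono' hψ.aestronglyMeasurable (Eventually.of_forall hL)
  -- Layer-cake formula for `ψ + L`, which takes values in `[0, 2L]`.
  have hlc : ∀ (μ : Measure Ω) [IsProbabilityMeasure μ],
      ∫ ω, ψ ω ∂μ + L = ∫ s in Set.Ioc 0 (2 * L), μ.real {ω | s ≤ ψ ω + L} := fun μ _ => by
    rw [← Integrable.integral_eq_integral_Ioc_meas_le (f := fun ω => ψ ω + L)
      ((hint μ).add (integrable_const L))
      (Eventually.of_forall fun ω => by have := (abs_le.1 (hL ω)).1; simp; linarith)
      (Eventually.of_forall fun ω => by have := (abs_le.1 (hL ω)).2; simp; linarith),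
      integral_add (hint μ) (integrable_const L)]
    simp
  have hanti : ∀ (μ : Measure Ω) [IsProbabilityMeasure μ],
      IntegrableOn (fun s => μ.real {ω | s ≤ ψ ω + L}) (Set.Ioc 0 (2 * L)) := fun μ _ => by
    have ha : Antitone fun s => μ.real {ω | s ≤ ψ ω + L} := fun a b hab =>
      measureReal_mono fun ω hω => le_trans hab hω
    exact Measure.integrableOn_of_bounded (M := 1) measure_Ioc_lt_top.ne ha.measurable.aestronglyMeasurable
      (Eventually.of_forall fun s => by
        rw [Real.norm_eq_abs, abs_of_nonneg measureReal_nonneg]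
        exact measureReal_le_one)
  have h : ∫ ω, ψ ω ∂p - ∫ ω, ψ ω ∂g = ∫ s in Set.Ioc 0 (2 * L),
      (p.real {ω | s ≤ ψ ω + L} - g.real {ω | s ≤ ψ ω + L}) := by
    rw [integral_sub (hanti p) (hanti g), ← hlc p, ← hlc g]
    ring
  have hL0 : 0 ≤ L := by
    have : Nonempty Ω := nonempty_of_isProbabilityMeasure p
    exact (abs_nonneg _).trans (hL this.some)
  rw [h, ← Real.norm_eq_abs]
  refine (norm_setIntegral_le_of_norm_le_const (C := δ) measure_Ioc_lt_top fun s _ => ?_).trans_eq ?_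
  · exact hd _ (measurableSet_le measurable_const (hψ.add_const L))
  · simp [Measure.real, hL0]
    ring

/-- A weak form of Pinsker's inequality, from `klFun x ≥ (√x - 1) ^ 2`. -/
lemma abs_measureReal_sub_le_klDiv {p g : Measure Ω} [IsProbabilityMeasure p]
    [IsProbabilityMeasure g] {ε : ℝ} (hε : 0 < ε) (hkl : InformationTheory.klDiv p g ≠ ∞)
    (s : Set Ω) :
    |p.real s - g.real s| ≤ ε + (1 + ε⁻¹) * (InformationTheory.klDiv p g).toReal := by
  obtain ⟨hac, hllr⟩ := InformationTheory.klDiv_ne_top_iff.1 hkl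
  rw [InformationTheory.toReal_klDiv_eq_integral_klFun hac]
  have hkint : Integrable (fun x => InformationTheory.klFun (p.rnDeriv g x).toReal) g :=
    (InformationTheory.integrable_klFun_rnDeriv_iff hac).2 hllr
  have hrint : Integrable (fun x => (p.rnDeriv g x).toReal) g := Measure.integrable_toReal_rnDeriv
  have hps : p.real s = ∫ x in s, (p.rnDeriv g x).toReal ∂g :=
    (Measure.setIntegral_toReal_rnDeriv hac s).symm
  have hgs : g.real s = ∫ _x in s, (1 : ℝ) ∂g := by simp
  -- With `x = y²`, the bound `log y ≥ 1 - 1/y` gives `klFun x ≥ (y - 1)²`; the linear part `2|y -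
  -- 1|` of `|y² - 1|` is absorbed by the arithmetic-geometric mean inequality with weight `ε`.
  have hpt : ∀ x : ℝ, 0 ≤ x → |x - 1| ≤ ε + (1 + ε⁻¹) * InformationTheory.klFun x := by
    intro x hx
    obtain ⟨y, hy, rfl⟩ : ∃ y, 0 ≤ y ∧ x = y ^ 2 := ⟨√x, Real.sqrt_nonneg x, (Real.sq_sqrt hx).symm⟩
    have hk : (y - 1) ^ 2 ≤ InformationTheory.klFun (y ^ 2) := by
      rw [InformationTheory.klFun_apply, Real.log_pow]
      rcases hy.eq_or_lt with rfl | hy0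
      · simp
      · have hl := Real.one_sub_inv_le_log_of_pos hy0
        have : y ^ 2 * (1 - y⁻¹) ≤ y ^ 2 * Real.log y := by gcongr
        have h2 : y ^ 2 * (1 - y⁻¹) = y ^ 2 - y := by field_simp
        push_cast
        nlinarith
    have h1 : |y ^ 2 - 1| ≤ (y - 1) ^ 2 + 2 * |y - 1| := by
      have : y ^ 2 - 1 = (y - 1) ^ 2 + 2 * (y - 1) := by ring
      rw [this]
      refine (abs_add_le _ _).trans ?_
      rw [abs_of_nonneg (sq_nonneg _), abs_mul, abs_two]
    have h2 : 2 * |y - 1| ≤ ε + ε⁻¹ * (y - 1) ^ 2 := by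
      have h3 := sq_nonneg (ε - |y - 1|)
      have h4 : ε * (2 * |y - 1|) ≤ ε * (ε + ε⁻¹ * (y - 1) ^ 2) := by
        have : ε * (ε + ε⁻¹ * (y - 1) ^ 2) = ε ^ 2 + |y - 1| ^ 2 := by
          rw [sq_abs]
          field_simp
        rw [this]
        nlinarith
      exact le_of_mul_le_mul_left h4 hε
    have h5 : (1 + ε⁻¹) * (y - 1) ^ 2 ≤ (1 + ε⁻¹) * InformationTheory.klFun (y ^ 2) := by gcongr
    nlinarith
  have hr1 : Integrable (fun x => (p.rnDeriv g x).toReal - 1) g := hrint.sub (integrable_const 1)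
  rw [hps, hgs, ← integral_sub hrint.integrableOn (integrable_const 1), ← Real.norm_eq_abs]
  calc ‖∫ x in s, ((p.rnDeriv g x).toReal - 1) ∂g‖
      ≤ ∫ x in s, |(p.rnDeriv g x).toReal - 1| ∂g := norm_integral_le_integral_norm _
    _ ≤ ∫ x, |(p.rnDeriv g x).toReal - 1| ∂g :=
        setIntegral_le_integral hr1.abs (Eventually.of_forall fun x => abs_nonneg _)
    _ ≤ ∫ x, (ε + (1 + ε⁻¹) * InformationTheory.klFun (p.rnDeriv g x).toReal) ∂g :=
        integral_mono hr1.abs ((integrable_const ε).add (hkint.const_mul _))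
          fun x => hpt _ ENNReal.toReal_nonneg
    _ = _ := by
        rw [integral_add (integrable_const ε) (hkint.const_mul _), integral_const_mul]
        simp

end GibbsSurface

/-! ### The class `𝓕` and the one-dimensional Gibbs law -/

namespace GibbsSurface

open ProbabilityTheory

variable {f : ℝ → EReal}

lemma ClassF.continuousOn_toReal (hf : ClassF f) :
    ContinuousOn (fun x => (f x).toReal) (Set.Ioi 0) := fun x hx =>
  (hf.diff x hx).continuousAt.continuousWithinAt

lemma ClassF.strictMonoOn_toReal (hf : ClassF f) :
    StrictMonoOn (fun x => (f x).toReal) (Set.Ioi 0) :=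
  strictMonoOn_of_deriv_pos (convex_Ioi 0) hf.continuousOn_toReal fun x hx =>
    hf.deriv_pos x (by simpa using hx)

lemma ClassF.toReal_nonneg_of_pos (hf : ClassF f) {x : ℝ} (hx : 0 < x) : 0 ≤ (f x).toReal := by
  have h1 : Tendsto f (𝓝[>] 0) (𝓝 0) := by
    have := hf.right_cont
    rw [ContinuousWithinAt, hf.map_zero] at this
    exact this.mono_left (nhdsWithin_mono _ Set.Ioi_subset_Ici_self)
  have h2 : Tendsto (fun y => (f y).toReal) (𝓝[>] 0) (𝓝 0) := by
    exact (EReal.tendsto_toReal (a := 0) (by simp) (by simp)).comp h1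
  refine le_of_tendsto h2 ?_
  filter_upwards [Ioo_mem_nhdsGT hx] with y hy
  exact (hf.strictMonoOn_toReal hy.1 hx hy.2).le

lemma ClassF.coe_toReal_of_pos (hf : ClassF f) {x : ℝ} (hx : 0 < x) : ((f x).toReal : EReal) = f x :=
  EReal.coe_toReal (hf.finite_pos x hx) (hf.ne_bot x)

/-- `f` is determined by its restriction to `(0, ∞)` in one of two ways. -/
lemma ClassF.eq_top_or_eq_abs (hf : ClassF f) (x : ℝ) :
    f x = ⊤ ∨ f x = ((f |x|).toReal : EReal) := by
  rcases lt_trichotomy x 0 with hx | rfl | hx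
  · rcases hf.side with h | h
    · exact Or.inl (h x hx)
    · right
      rw [abs_of_neg hx, hf.coe_toReal_of_pos (by linarith), ← h x]
  · right
    simp [hf.map_zero]
  · right
    rw [abs_of_pos hx, hf.coe_toReal_of_pos hx]

lemma ClassF.toReal_nonneg (hf : ClassF f) (x : ℝ) : 0 ≤ (f x).toReal := by
  rcases hf.eq_top_or_eq_abs x with h | h
  · simp [h]
  · rw [h, EReal.toReal_coe]
    rcases (abs_nonneg x).eq_or_lt with h0 | h0
    · simp [← h0, hf.map_zero]
    · exact hf.toReal_nonneg_of_pos h0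

lemma ClassF.measurable (hf : ClassF f) : Measurable f := by
  classical
  have hu : Measurable ((Set.Ioi (0 : ℝ)).piecewise (fun x => (f x).toReal) fun _ => 0) :=
    hf.continuousOn_toReal.measurable_piecewise continuousOn_const measurableSet_Ioi
  have habs : ∀ x, (f |x|).toReal =
      (Set.Ioi (0 : ℝ)).piecewise (fun x => (f x).toReal) (fun _ => 0) |x| := fun x => by
    rcases (abs_nonneg x).eq_or_lt with h0 | h0
    · simp [← h0, hf.map_zero]
    · rw [Set.piecewise_eq_of_mem _ _ _ (Set.mem_Ioi.2 h0)]
  have hm : Measurable fun x : ℝ => ((f |x|).toReal : EReal) := by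
    simp only [habs]
    exact (hu.comp (by fun_prop : Measurable fun x : ℝ => |x|)).coe_real_ereal
  rcases hf.side with h | h
  · have : f = (Set.Iio (0 : ℝ)).piecewise (fun _ => ⊤) fun x => ((f |x|).toReal : EReal) := by
      ext x
      by_cases hx : x < 0
      · rw [Set.piecewise_eq_of_mem _ _ _ (Set.mem_Iio.2 hx), h x hx]
      · rw [Set.piecewise_eq_of_notMem _ _ _ (Set.notMem_Iio.2 (not_lt.1 hx))]
        rcases (not_lt.1 hx).eq_or_lt with rfl | h0
        · simp [hf.map_zero]
        · rw [abs_of_pos h0, hf.coe_toReal_of_pos h0]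
    rw [this]
    exact Measurable.piecewise measurableSet_Iio measurable_const hm
  · convert hm using 1
    ext x
    rcases lt_trichotomy x 0 with hx | rfl | hx
    · rw [abs_of_neg hx, hf.coe_toReal_of_pos (by linarith), ← h x]
    · simp [hf.map_zero]
    · rw [abs_of_pos hx, hf.coe_toReal_of_pos hx]

/-- Mean value inequality beyond `max a₂ 1`, a starting point that is positive so that `f` is
differentiable there. This growth makes all Gibbs moments of `f` finite. -/
lemma ClassF.exists_linear_le (hf : ClassF f) :
    ∃ a b : ℝ, 0 < a ∧ ∀ x, 0 ≤ x → a * x - b ≤ (f x).toReal := by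
  obtain ⟨a₁, a₂, ha, hd⟩ := hf.tail
  have hx0 : 0 < max a₂ 1 := lt_max_of_lt_right one_pos
  refine ⟨a₁, a₁ * max a₂ 1, ha, fun x hx => ?_⟩
  rcases le_total x (max a₂ 1) with h | h
  · have : a₁ * x ≤ a₁ * max a₂ 1 := by gcongr
    linarith [hf.toReal_nonneg x]
  · have hsub : Set.Ici (max a₂ 1) ⊆ Set.Ioi (0 : ℝ) := fun y hy => hx0.trans_le hy
    have := (convex_Ici (max a₂ 1)).mul_sub_le_image_sub_of_le_deriv (C := a₁)
      (hf.continuousOn_toReal.mono hsub)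
      (fun y hy => (hf.diff y (hsub (interior_subset hy))).differentiableWithinAt)
      (fun y hy => by
        have hy' : max a₂ 1 < y := by simpa using hy
        exact hd y (hx0.trans hy') ((le_max_left _ _).trans_lt hy'))
      _ Set.self_mem_Ici x h h
    linarith [hf.toReal_nonneg (max a₂ 1)]

lemma integrable_exp_neg_mul_abs {b : ℝ} (hb : 0 < b) :
    Integrable fun x : ℝ => Real.exp (-(b * |x|)) := by
  rw [← integrableOn_univ, ← Set.Iic_union_Ioi (a := (0 : ℝ)), integrableOn_union]
  constructor
  · refine (integrableOn_exp_mul_Iic hb 0).congr_fun (fun x hx => ?_) measurableSet_Iic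
    simp [abs_of_nonpos (Set.mem_Iic.1 hx)]
  · refine (integrableOn_exp_mul_Ioi (neg_lt_zero.2 hb) 0).congr_fun (fun x hx => ?_)
      measurableSet_Ioi
    simp [abs_of_pos (Set.mem_Ioi.1 hx)]

/-- The unnormalized one-dimensional Gibbs weight. -/
noncomputable def weight (f : ℝ → EReal) (c x : ℝ) : ℝ≥0∞ := EReal.exp (-((c : EReal) * f x))

lemma ClassF.measurable_weight (hf : ClassF f) (c : ℝ) : Measurable (weight f c) := by
  have h1 : Measurable fun x => (c : EReal) * f x := (measurable_const_mul _).comp hf.measurable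
  exact EReal.measurable_exp.comp h1.neg

lemma weight_of_eq_top {c x : ℝ} (hc : 0 < c) (h : f x = ⊤) : weight f c x = 0 := by
  simp [weight, h, EReal.coe_mul_top_of_pos hc]

lemma weight_of_eq_coe {c x y : ℝ} (h : f x = (y : EReal)) :
    weight f c x = ENNReal.ofReal (Real.exp (-(c * y))) := by
  rw [weight, h, ← EReal.coe_mul, ← EReal.coe_neg, EReal.exp_coe]

lemma ClassF.weight_ne_top (hf : ClassF f) {c : ℝ} (hc : 0 < c) (x : ℝ) : weight f c x ≠ ∞ := by
  rcases hf.eq_top_or_eq_abs x with h | h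
  · simp [weight_of_eq_top hc h]
  · simp [weight_of_eq_coe h]

lemma ClassF.weight_ne_zero (hf : ClassF f) {c x : ℝ} (hx : 0 < x) : weight f c x ≠ 0 := by
  rw [weight_of_eq_coe (hf.coe_toReal_of_pos hx).symm]
  simp [Real.exp_pos]

/-- Half of the exponent absorbs the power of `f`, by `y ^ j / j! ≤ exp y`; linear growth turns the
other half into decay in `|x|`. -/
lemma ClassF.exists_weight_mul_pow_le (hf : ClassF f) {c : ℝ} (hc : 0 < c) (j : ℕ) :
    ∃ b C : ℝ, 0 < b ∧
      ∀ x, (weight f c x).toReal * (f x).toReal ^ j ≤ C * Real.exp (-(b * |x|)) := by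
  obtain ⟨a, d, ha, hlin⟩ := hf.exists_linear_le
  refine ⟨c / 2 * a, j.factorial * (2 / c) ^ j * Real.exp (c / 2 * d), by positivity, fun x => ?_⟩
  rcases hf.eq_top_or_eq_abs x with h | h
  · rw [weight_of_eq_top hc h]
    simp only [ENNReal.toReal_zero, zero_mul]
    positivity
  · set y := (f |x|).toReal with hy
    have hy0 : 0 ≤ y := hf.toReal_nonneg _
    rw [weight_of_eq_coe h, h, EReal.toReal_coe, ENNReal.toReal_ofReal (Real.exp_pos _).le]
    have h1 : y ^ j ≤ j.factorial * (2 / c) ^ j * Real.exp (c / 2 * y) := by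
      have h2 := Real.pow_div_factorial_le_exp (x := c / 2 * y) (by positivity) j
      rw [div_le_iff₀ (by positivity)] at h2
      have h3 : y ^ j = (2 / c) ^ j * (c / 2 * y) ^ j := by
        rw [← mul_pow]
        congr 1
        field_simp
      rw [h3]
      calc (2 / c) ^ j * (c / 2 * y) ^ j ≤ (2 / c) ^ j * (Real.exp (c / 2 * y) * j.factorial) := by
            gcongr
        _ = _ := by ring
    calc Real.exp (-(c * y)) * y ^ j
        ≤ Real.exp (-(c * y)) * (j.factorial * (2 / c) ^ j * Real.exp (c / 2 * y)) := by gcongr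
      _ = j.factorial * (2 / c) ^ j * Real.exp (-(c / 2 * y)) := by
          have : Real.exp (-(c * y)) * Real.exp (c / 2 * y) = Real.exp (-(c / 2 * y)) := by
            rw [← Real.exp_add]
            congr 1
            ring
          rw [← this]
          ring
      _ ≤ j.factorial * (2 / c) ^ j * Real.exp (c / 2 * d + -(c / 2 * a * |x|)) := by
          gcongr
          have := hlin |x| (abs_nonneg x)
          nlinarith
      _ = _ := by
          rw [Real.exp_add]
          ring

lemma ClassF.integrable_weight_mul_pow (hf : ClassF f) {c : ℝ} (hc : 0 < c) (j : ℕ) :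
    Integrable fun x => (weight f c x).toReal * (f x).toReal ^ j := by
  obtain ⟨b, C, hb, h⟩ := hf.exists_weight_mul_pow_le hc j
  refine ((integrable_exp_neg_mul_abs hb).const_mul C).mono'
    ((hf.measurable_weight c).ennreal_toReal.mul
      (hf.measurable.ereal_toReal.pow_const j)).aestronglyMeasurable
    (Eventually.of_forall fun x => ?_)
  rw [Real.norm_eq_abs, abs_of_nonneg (mul_nonneg ENNReal.toReal_nonneg
    (pow_nonneg (hf.toReal_nonneg x) j))]
  exact h x

lemma Z_eq_lintegral_weight (f : ℝ → EReal) (c : ℝ) : Z f c = ∫⁻ x, weight f c x := rfl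

lemma ClassF.Z_ne_top (hf : ClassF f) {c : ℝ} (hc : 0 < c) : Z f c ≠ ∞ := by
  have h : Integrable fun x => (weight f c x).toReal := by
    simpa using hf.integrable_weight_mul_pow hc 0
  rw [Z_eq_lintegral_weight]
  have h2 := h.lintegral_lt_top
  simp only [ENNReal.ofReal_toReal (hf.weight_ne_top hc _)] at h2
  exact h2.ne

lemma ClassF.Z_ne_zero (hf : ClassF f) (c : ℝ) : Z f c ≠ 0 := by
  rw [Z_eq_lintegral_weight, Ne, lintegral_eq_zero_iff (hf.measurable_weight c)]
  intro h
  have h2 : volume (Set.Ioi (0 : ℝ)) = 0 :=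
    measure_mono_null (fun x hx => hf.weight_ne_zero (c := c) hx) (ae_iff.1 h)
  simp at h2

/-- The one-dimensional Gibbs law. -/
noncomputable def gibbsOne (f : ℝ → EReal) (c : ℝ) : Measure ℝ :=
  volume.withDensity fun x => weight f c x / Z f c

lemma ClassF.measurable_weight_div (hf : ClassF f) (c : ℝ) :
    Measurable fun x => weight f c x / Z f c := (hf.measurable_weight c).div_const _

lemma ClassF.weight_div_lt_top (hf : ClassF f) {c : ℝ} (hc : 0 < c) (x : ℝ) :
    weight f c x / Z f c < ∞ := ENNReal.div_lt_top (hf.weight_ne_top hc x) (hf.Z_ne_zero c)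

lemma ClassF.isProbabilityMeasure_gibbsOne (hf : ClassF f) {c : ℝ} (hc : 0 < c) :
    IsProbabilityMeasure (gibbsOne f c) := by
  constructor
  rw [gibbsOne, withDensity_apply _ MeasurableSet.univ, Measure.restrict_univ]
  simp only [div_eq_mul_inv]
  rw [lintegral_mul_const _ (hf.measurable_weight c), ← Z_eq_lintegral_weight]
  exact ENNReal.mul_inv_cancel (hf.Z_ne_zero c) (hf.Z_ne_top hc)

lemma ClassF.integrable_pow_gibbsOne (hf : ClassF f) {c : ℝ} (hc : 0 < c) (j : ℕ) :
    Integrable (fun x => (f x).toReal ^ j) (gibbsOne f c) := by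
  rw [gibbsOne, integrable_withDensity_iff_integrable_smul' (hf.measurable_weight_div c)
    (Eventually.of_forall (hf.weight_div_lt_top hc))]
  refine ((hf.integrable_weight_mul_pow hc j).const_mul (Z f c).toReal⁻¹).congr
    (Eventually.of_forall fun x => ?_)
  simp only [smul_eq_mul, ENNReal.toReal_div]
  ring

lemma ClassF.integrable_sub_pow_four_gibbsOne (hf : ClassF f) {c : ℝ} (hc : 0 < c) (t : ℝ) :
    Integrable (fun x => ((f x).toReal - t) ^ 4) (gibbsOne f c) := by
  have := hf.isProbabilityMeasure_gibbsOne hc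
  refine (((hf.integrable_pow_gibbsOne hc 4).add (integrable_const (t ^ 4))).const_mul 8).mono'
    ((hf.measurable.ereal_toReal.sub_const t).pow_const 4).aestronglyMeasurable
    (Eventually.of_forall fun x => ?_)
  simp only [Pi.add_apply]
  rw [Real.norm_eq_abs, abs_of_nonneg (by positivity)]
  nlinarith [sq_nonneg ((f x).toReal + t), sq_nonneg ((f x).toReal ^ 2 - t ^ 2),
    sq_nonneg (((f x).toReal + t) ^ 2), sq_nonneg ((f x).toReal - t)]

/-- Zero would force `f = t` almost surely, but the density is positive on `(0, ∞)`, where the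
strictly increasing `f` takes the value `t` at most once. -/
lemma ClassF.integral_sub_sq_gibbsOne_pos (hf : ClassF f) {c : ℝ} (hc : 0 < c) (t : ℝ) :
    0 < ∫ x, ((f x).toReal - t) ^ 2 ∂(gibbsOne f c) := by
  have := hf.isProbabilityMeasure_gibbsOne hc
  refine lt_of_le_of_ne (integral_nonneg fun x => sq_nonneg _) fun h => ?_
  have hint : Integrable (fun x => ((f x).toReal - t) ^ 2) (gibbsOne f c) :=
    integrable_pow_of_pow_four (hf.measurable.ereal_toReal.sub_const t)
      (hf.integrable_sub_pow_four_gibbsOne hc t) (by norm_num)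
  have h0 := (integral_eq_zero_iff_of_nonneg (fun x => sq_nonneg _) hint).1 h.symm
  rw [gibbsOne, Filter.EventuallyEq, ae_withDensity_iff (hf.measurable_weight_div c)] at h0
  have h1 : volume (Set.Ioi (0 : ℝ) ∩ {x | (f x).toReal = t}) = 0 := by
    refine Set.Subsingleton.measure_zero (fun x hx y hy => ?_) _
    exact hf.strictMonoOn_toReal.injOn hx.1 hy.1 (hx.2.trans hy.2.symm)
  have h2 : volume (Set.Ioi (0 : ℝ) \ {x | (f x).toReal = t}) = 0 := by
    refine measure_mono_null (fun x hx => ?_) (ae_iff.1 h0)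
    simp only [Set.mem_ofPred_eq, Classical.not_imp]
    refine ⟨ENNReal.div_ne_zero.2 ⟨hf.weight_ne_zero hx.1, hf.Z_ne_top hc⟩, fun h => ?_⟩
    simp only [Pi.zero_apply, ne_eq, OfNat.ofNat_ne_zero, not_false_eq_true, pow_eq_zero_iff,
      sub_eq_zero] at h
    exact hx.2 h
  have h3 := measure_inter_add_sdiff₀ (μ := volume) (Set.Ioi (0 : ℝ))
    (t := {x | (f x).toReal = t})
    (hf.measurable.ereal_toReal (measurableSet_singleton t)).nullMeasurableSet
  rw [h1, h2] at h3
  simp at h3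

/-! ### Product structure of the Gibbs law -/

lemma sum_ne_bot {ι : Type*} (s : Finset ι) {a : ι → EReal} (ha : ∀ i, a i ≠ ⊥) :
    ∑ i ∈ s, a i ≠ ⊥ := by
  classical
  induction s using Finset.induction_on with
  | empty => simp
  | insert i s hi ih =>
    rw [Finset.sum_insert hi]
    exact EReal.add_ne_bot_iff.2 ⟨ha i, ih⟩

lemma coe_mul_ne_bot {c : ℝ} (hc : 0 < c) {a : EReal} (ha : a ≠ ⊥) : (c : EReal) * a ≠ ⊥ := by
  induction a with
  | bot => exact absurd rfl ha
  | coe y => rw [← EReal.coe_mul]; exact EReal.coe_ne_bot _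
  | top => simp [EReal.coe_mul_top_of_pos hc]

/-- Excluding `⊥` is essential: `⊤ + ⊥ = ⊥` would give `∞` on the left and `0 * ∞ = 0` on the right.
-/
lemma exp_neg_mul_sum {ι : Type*} (s : Finset ι) {c : ℝ} (hc : 0 < c) {a : ι → EReal}
    (ha : ∀ i, a i ≠ ⊥) :
    EReal.exp (-((c : EReal) * ∑ i ∈ s, a i)) = ∏ i ∈ s, EReal.exp (-((c : EReal) * a i)) := by
  classical
  induction s using Finset.induction_on with
  | empty => simp
  | insert i s hi ih =>
    rw [Finset.sum_insert hi, Finset.prod_insert hi, ← ih,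
      EReal.left_distrib_of_nonneg_of_ne_top (EReal.coe_nonneg.2 hc.le) (EReal.coe_ne_top c),
      EReal.neg_add (Or.inl (coe_mul_ne_bot hc (ha i)))
        (Or.inr (coe_mul_ne_bot hc (sum_ne_bot s ha))), sub_eq_add_neg, EReal.exp_add]

lemma ClassF.gibbsDensity_eq_prod (hf : ClassF f) {c : ℝ} (hc : 0 < c) (n : ℕ) (x : E n) :
    gibbsDensity f c n x = ∏ i, weight f c (x i) / Z f c := by
  rw [gibbsDensity, R, exp_neg_mul_sum _ hc fun i => hf.ne_bot _]
  simp only [div_eq_mul_inv, Finset.prod_mul_distrib, Finset.prod_const, Finset.card_univ,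
    Fintype.card_fin, ENNReal.inv_pow, weight]

/-- Checked on boxes, where the restricted density is still a product. Finiteness of `g` allows
passing to real integrals, to which Fubini for finite products applies. -/
lemma withDensity_prod_eq_pi {ι : Type*} [Fintype ι] {g : ℝ → ℝ≥0∞} (hg : Measurable g)
    (hgt : ∀ x, g x ≠ ∞) (hgi : ∫⁻ x, g x ≠ ∞) :
    (volume : Measure (ι → ℝ)).withDensity (fun x => ∏ i, g (x i)) =
      Measure.pi fun _ => volume.withDensity g := by
  have : IsFiniteMeasure (volume.withDensity g) := isFiniteMeasure_withDensity hgi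
  symm
  refine Measure.pi_eq fun s hs => ?_
  have hS : MeasurableSet (Set.univ.pi s) := MeasurableSet.univ_pi hs
  rw [withDensity_apply _ hS]
  simp only [withDensity_apply _ (hs _)]
  rw [← lintegral_indicator hS]
  simp only [← lintegral_indicator (hs _)]
  have hint : ∀ i, Integrable fun x => ((s i).indicator g x).toReal := fun i => by
    refine integrable_toReal_of_lintegral_ne_top (hg.indicator (hs i)).aemeasurable ?_
    exact ((lintegral_mono (Set.indicator_le_self _ _)).trans_lt hgi.lt_top).ne
  have hfin : ∀ i x, (s i).indicator g x ≠ ∞ := fun i x => by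
    by_cases hx : x ∈ s i <;> simp [hx, hgt x]
  have hprod : ∀ x : ι → ℝ, (Set.univ.pi s).indicator (fun x => ∏ i, g (x i)) x =
      ENNReal.ofReal (∏ i, ((s i).indicator g (x i)).toReal) := fun x => by
    rw [← ENNReal.toReal_prod, ENNReal.ofReal_toReal (ENNReal.prod_ne_top fun i _ => hfin i _)]
    by_cases hx : x ∈ Set.univ.pi s
    · rw [Set.indicator_of_mem hx]
      exact Finset.prod_congr rfl fun i _ => (Set.indicator_of_mem (hx i trivial) _).symm
    · rw [Set.indicator_of_notMem hx]
      obtain ⟨i, hi⟩ : ∃ i, x i ∉ s i := by simpa [Set.mem_pi] using hx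
      exact (Finset.prod_eq_zero (Finset.mem_univ i) (Set.indicator_of_notMem hi _)).symm
  simp only [hprod]
  rw [volume_pi, ← ofReal_integral_eq_lintegral_ofReal (Integrable.fintype_prod hint)
    (Eventually.of_forall fun x => Finset.prod_nonneg fun i _ => ENNReal.toReal_nonneg),
    integral_fintype_prod_eq_prod (f := fun i x => ((s i).indicator g x).toReal),
    ENNReal.ofReal_prod_of_nonneg fun i _ => integral_nonneg fun x => ENNReal.toReal_nonneg]
  refine Finset.prod_congr rfl fun i _ => ?_
  rw [ofReal_integral_eq_lintegral_ofReal (hint i)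
    (Eventually.of_forall fun x => ENNReal.toReal_nonneg)]
  simp only [ENNReal.ofReal_toReal (hfin i _)]

/-- The Gibbs law on `ℝⁿ` is the `n`-fold product of the one-dimensional one. -/
lemma ClassF.map_ofLp_gibbs (hf : ClassF f) {c : ℝ} (hc : 0 < c) (n : ℕ) :
    (gibbs f c n).map (WithLp.ofLp : E n → Fin n → ℝ) = Measure.pi fun _ => gibbsOne f c := by
  have hfin : ∫⁻ x, weight f c x / Z f c ≠ ∞ := by
    have := hf.isProbabilityMeasure_gibbsOne hc
    have h := measure_ne_top (gibbsOne f c) Set.univ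
    rwa [gibbsOne, withDensity_apply _ MeasurableSet.univ, Measure.restrict_univ] at h
  have hvp := PiLp.volume_preserving_ofLp (Fin n)
  have hme : Measurable (WithLp.ofLp : E n → Fin n → ℝ) := hvp.measurable
  unfold gibbsOne
  rw [← withDensity_prod_eq_pi (hf.measurable_weight_div c)
    (fun x => (hf.weight_div_lt_top hc x).ne) hfin]
  ext s hs
  have hprodm : Measurable fun y : Fin n → ℝ => ∏ i, weight f c (y i) / Z f c :=
    Finset.measurable_fun_prod _ fun i _ => (hf.measurable_weight_div c).comp (measurable_pi_apply i)
  rw [Measure.map_apply hme hs, gibbs, withDensity_apply _ (hme hs), withDensity_apply _ hs,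
    ← hvp.setLIntegral_comp_preimage hs hprodm]
  simp only [hf.gibbsDensity_eq_prod hc]

lemma ClassF.isProbabilityMeasure_gibbs (hf : ClassF f) {c : ℝ} (hc : 0 < c) (n : ℕ) :
    IsProbabilityMeasure (gibbs f c n) := by
  have := hf.isProbabilityMeasure_gibbsOne hc
  have hme : Measurable (WithLp.ofLp : E n → Fin n → ℝ) :=
    (PiLp.volume_preserving_ofLp (Fin n)).measurable
  constructor
  have h : (gibbs f c n).map (WithLp.ofLp : E n → Fin n → ℝ) Set.univ = 1 := by
    rw [hf.map_ofLp_gibbs hc]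
    exact measure_univ
  rwa [Measure.map_apply hme MeasurableSet.univ, Set.preimage_univ] at h

lemma measurable_apply {n : ℕ} (i : Fin n) : Measurable fun x : E n => x i :=
  (measurable_pi_apply i).comp (PiLp.volume_preserving_ofLp (Fin n)).measurable

lemma ClassF.map_apply_gibbs (hf : ClassF f) {c : ℝ} (hc : 0 < c) {n : ℕ} (i : Fin n) :
    (gibbs f c n).map (fun x => x i) = gibbsOne f c := by
  have := hf.isProbabilityMeasure_gibbsOne hc
  have h := Measure.map_map (μ := gibbs f c n) (measurable_pi_apply (X := fun _ : Fin n => ℝ) i)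
    (PiLp.volume_preserving_ofLp (Fin n)).measurable
  rw [hf.map_ofLp_gibbs hc, (measurePreserving_eval _ i).map_eq] at h
  exact h.symm

lemma ClassF.iIndepFun_apply_gibbs (hf : ClassF f) {c : ℝ} (hc : 0 < c) (n : ℕ) :
    iIndepFun (fun (i : Fin n) (x : E n) => x i) (gibbs f c n) := by
  have := hf.isProbabilityMeasure_gibbs hc n
  rw [iIndepFun_iff_map_fun_eq_pi_map fun i => (measurable_apply i).aemeasurable]
  simp only [hf.map_apply_gibbs hc]
  exact hf.map_ofLp_gibbs hc n

/-! ### Centered energies and their moments -/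

/-- The centered energy of a coordinate. -/
noncomputable def centered (f : ℝ → EReal) (t x : ℝ) : ℝ := (f x).toReal - t

lemma ClassF.measurable_centered (hf : ClassF f) (t : ℝ) : Measurable (centered f t) :=
  hf.measurable.ereal_toReal.sub_const t

lemma ClassF.iIndepFun_centered_gibbs (hf : ClassF f) {c : ℝ} (hc : 0 < c) (t : ℝ) (n : ℕ) :
    iIndepFun (fun (i : Fin n) (x : E n) => centered f t (x i)) (gibbs f c n) :=
  (hf.iIndepFun_apply_gibbs hc n).comp (fun _ => centered f t) fun _ => hf.measurable_centered t

lemma ClassF.integral_comp_apply_gibbs (hf : ClassF f) {c : ℝ} (hc : 0 < c) {n : ℕ} (i : Fin n)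
    {g : ℝ → ℝ} (hg : Measurable g) :
    ∫ x, g (x i) ∂(gibbs f c n) = ∫ y, g y ∂(gibbsOne f c) := by
  rw [← hf.map_apply_gibbs hc i, integral_map (measurable_apply i).aemeasurable
    hg.aestronglyMeasurable]

lemma ClassF.integral_centered_gibbsOne (hf : ClassF f) {c t : ℝ} (hc : 0 < c)
    (hct : energy f 1 (gibbsDensity f c 1) = t) : ∫ x, centered f t x ∂(gibbsOne f c) = 0 := by
  have hprob := hf.isProbabilityMeasure_gibbsOne hc
  have hden : Measurable (gibbsDensity f c 1) := by
    have : gibbsDensity f c 1 = fun x : E 1 => ∏ i, weight f c (x i) / Z f c :=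
      funext (hf.gibbsDensity_eq_prod hc 1)
    rw [this]
    exact Finset.measurable_fun_prod _ fun i _ =>
      (hf.measurable_weight_div c).comp (measurable_apply i)
  have h1 : ∫ x : E 1, (f (x 0)).toReal ∂(gibbs f c 1) = t := by
    rw [gibbs, integral_withDensity_eq_integral_toReal_smul hden]
    · rw [← hct, energy]
      simp [R]
    · refine Eventually.of_forall fun x => ?_
      rw [hf.gibbsDensity_eq_prod hc]
      exact (ENNReal.prod_ne_top fun i _ => (hf.weight_div_lt_top hc _).ne).lt_top
  rw [hf.integral_comp_apply_gibbs hc 0 hf.measurable.ereal_toReal] at h1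
  unfold centered
  rw [integral_sub (by simpa using hf.integrable_pow_gibbsOne hc 1) (integrable_const t), h1]
  simp

/-- Moments of block sums of centered energies under the Gibbs law. -/
lemma ClassF.exists_moment_bounds (hf : ClassF f) {c t : ℝ} (hc : 0 < c)
    (hct : energy f 1 (gibbsDensity f c 1) = t) :
    ∃ v C : ℝ, 0 < v ∧ 0 < C ∧ ∀ (k : ℕ) (A : Finset (Fin k)),
      Integrable (fun x => (∑ i ∈ A, centered f t (x i)) ^ 4) (gibbs f c k) ∧
      ∫ x, ∑ i ∈ A, centered f t (x i) ∂(gibbs f c k) = 0 ∧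
      ∫ x, (∑ i ∈ A, centered f t (x i)) ^ 2 ∂(gibbs f c k) = A.card * v ∧
      ∫ x, (∑ i ∈ A, centered f t (x i)) ^ 4 ∂(gibbs f c k) ≤ C * A.card ^ 2 := by
  set v := ∫ x, centered f t x ^ 2 ∂(gibbsOne f c) with hv
  set m := ∫ x, centered f t x ^ 4 ∂(gibbsOne f c) with hm
  have hv0 : 0 < v := hf.integral_sub_sq_gibbsOne_pos hc t
  have hm0 : 0 ≤ m := integral_nonneg fun x => by positivity
  refine ⟨v, 3 * v ^ 2 + m, hv0, by positivity, fun k A => ?_⟩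
  have := hf.isProbabilityMeasure_gibbs hc k
  have hmc := hf.measurable_centered t
  obtain ⟨h4, h1, h2, h4'⟩ := moments_sum_of_iIndepFun
    (X := fun (i : Fin k) (x : E k) => centered f t (x i)) (v := v) (m := m)
    (fun i => hmc.comp (measurable_apply i)) (hf.iIndepFun_centered_gibbs hc t k)
    (fun i => by
      have h : Integrable (fun x => centered f t x ^ 4) (gibbsOne f c) :=
        hf.integrable_sub_pow_four_gibbsOne hc t
      rw [← hf.map_apply_gibbs hc i, integrable_map_measure
        (hmc.pow_const 4).aestronglyMeasurable (measurable_apply i).aemeasurable] at h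
      exact h)
    (fun i => by rw [hf.integral_comp_apply_gibbs hc i hmc, hf.integral_centered_gibbsOne hc hct])
    (fun i => hf.integral_comp_apply_gibbs hc i (hmc.pow_const 2))
    (fun i => hf.integral_comp_apply_gibbs hc i (hmc.pow_const 4)) A
  refine ⟨h4, h1, h2, h4'.trans ?_⟩
  have hcard : (A.card : ℝ) ≤ (A.card : ℝ) ^ 2 := by
    exact_mod_cast Nat.le_self_pow (by norm_num) _
  nlinarith

end GibbsSurface

/-! ### Exchangeability of the surface law -/

namespace GibbsSurface

open ProbabilityTheory

variable {f : ℝ → EReal} {n k : ℕ}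

/-- Permutation of coordinates as a linear isometry of `ℝⁿ`. -/
noncomputable def permIso (π : Equiv.Perm (Fin n)) : E n ≃ₗᵢ[ℝ] E n :=
  LinearIsometryEquiv.piLpCongrLeft 2 ℝ ℝ π

lemma permIso_apply (π : Equiv.Perm (Fin n)) (x : E n) (i : Fin n) :
    permIso π x i = x (π.symm i) := rfl

lemma R_permIso (f : ℝ → EReal) (π : Equiv.Perm (Fin n)) (x : E n) :
    R f n (permIso π x) = R f n x := by
  simp only [R, permIso_apply]
  exact Equiv.sum_comp π.symm fun i => f (x i)

lemma permIso_mem_surface (f : ℝ → EReal) (t : ℝ) (π : Equiv.Perm (Fin n)) (x : E n) :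
    permIso π x ∈ surface f n t ↔ x ∈ surface f n t := by
  simp only [surface, Set.mem_ofPred_eq, R_permIso]

lemma centralProj_permIso (f : ℝ → EReal) (t : ℝ) (π : Equiv.Perm (Fin n)) (x : E n) :
    centralProj f n t (permIso π x) = permIso π (centralProj f n t x) := by
  simp only [centralProj, ← map_smul, permIso_mem_surface]

/-- The action of a permutation on the space of coordinates `(r, s)`. -/
noncomputable def coordsIso (π : Equiv.Perm (Fin n)) :
    WithLp 2 (ℝ × E n) ≃ₗᵢ[ℝ] WithLp 2 (ℝ × E n) :=
  LinearIsometryEquiv.withLpProdCongr 2 (LinearIsometryEquiv.refl ℝ ℝ) (permIso π)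

lemma coords_permIso (f : ℝ → EReal) (t : ℝ) (π : Equiv.Perm (Fin n)) :
    coords f n t ∘ permIso π = coordsIso π ∘ coords f n t := by
  ext x
  simp [coords, coordsIso, R_permIso, centralProj_permIso]

/-- The factor contributed by `Q` is that of its restriction to the range of `D`, again an isometry.
-/
lemma normDet_linearIsometry_comp {U V W : Type*} [NormedAddCommGroup U]
    [InnerProductSpace ℝ U] [FiniteDimensional ℝ U] [NormedAddCommGroup V] [InnerProductSpace ℝ V]
    [NormedAddCommGroup W] [InnerProductSpace ℝ W] (D : U →ₗ[ℝ] V) (Q : V →ₗᵢ[ℝ] W) :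
    (Q.toLinearMap ∘ₗ D).normDet = D.normDet := by
  rw [LinearMap.normDet_comp]
  have h := (Q.comp (LinearMap.range D).subtypeₗᵢ).normDet_eq_one
  have h2 : (Q.comp (LinearMap.range D).subtypeₗᵢ).toLinearMap =
      Q.toLinearMap.domRestrict (LinearMap.range D) := rfl
  rw [h2] at h
  rw [h, one_mul]

/-- Differentiate `coords_permIso`: the permutations on both sides are isometries, with volume
factor one. The chain rule with a linear equivalence requires no differentiability of `coords`. -/
lemma jacobianA_permIso (f : ℝ → EReal) (t : ℝ) (π : Equiv.Perm (Fin n)) (x : E n) :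
    jacobianA f n t (permIso π x) = jacobianA f n t x := by
  have h1 : fderiv ℝ (coords f n t ∘ permIso π) x =
      (fderiv ℝ (coords f n t) (permIso π x)).comp
        ((permIso π).toContinuousLinearEquiv : E n →L[ℝ] E n) :=
    (permIso π).toContinuousLinearEquiv.comp_right_fderiv
  have h2 : fderiv ℝ (coordsIso π ∘ coords f n t) x =
      ((coordsIso π).toContinuousLinearEquiv : _ →L[ℝ] _).comp (fderiv ℝ (coords f n t) x) :=
    (coordsIso π).comp_fderiv
  rw [coords_permIso, h2] at h1
  have h3 : (coordsIso π).toLinearIsometry.toLinearMap ∘ₗ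
      (fderiv ℝ (coords f n t) x).toLinearMap =
      (fderiv ℝ (coords f n t) (permIso π x)).toLinearMap ∘ₗ
        (permIso π).toLinearIsometry.toLinearMap := congrArg ContinuousLinearMap.toLinearMap h1
  have h4 := congrArg LinearMap.normDet h3
  rw [normDet_linearIsometry_comp, LinearMap.normDet_comp_of_finrank_eq _ _ rfl,
    LinearIsometry.normDet_eq_one, mul_one] at h4
  rw [jacobianA, jacobianA, h4]

/-- The squared volume factor is a Gram determinant, hence polynomial in inner products of
directional derivatives, which are measurable. -/
lemma measurable_jacobianA (f : ℝ → EReal) (n : ℕ) (t : ℝ) : Measurable (jacobianA f n t) := by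
  have h : ∀ x, jacobianA f n t x = (√(Matrix.gram ℝ fun i =>
      fderiv ℝ (coords f n t) x (EuclideanSpace.basisFun (Fin n) ℝ i)).det)⁻¹ := fun x => by
    have := LinearMap.normDet_sq_eq_det_gram (fderiv ℝ (coords f n t) x).toLinearMap
      (EuclideanSpace.basisFun (Fin n) ℝ)
    rw [jacobianA, ← Real.sqrt_sq (LinearMap.normDet_nonneg _)]
    congr 2
  rw [funext h]
  refine (Real.continuous_sqrt.measurable.comp ?_).inv
  simp only [Matrix.det_apply]
  refine Finset.measurable_fun_sum _ fun σ _ => Measurable.const_smul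
    (Finset.measurable_fun_prod _ fun i _ => ?_) _
  simp only [Matrix.gram_apply]
  exact (measurable_fderiv_apply_const ℝ (coords f n t) _).inner
    (measurable_fderiv_apply_const ℝ (coords f n t) _)

lemma measurePreserving_permIso_surfaceVolume (f : ℝ → EReal) (t : ℝ) (π : Equiv.Perm (Fin n)) :
    MeasurePreserving (permIso π) (surfaceVolume f n t) (surfaceVolume f n t) := by
  have h := ((permIso π).toIsometryEquiv.measurePreserving_euclideanHausdorffMeasure
    (n - 1)).restrict_preimage_emb
      (permIso π).toHomeomorph.toMeasurableEquiv.measurableEmbedding (surface f n t)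
  have h2 : permIso π ⁻¹' surface f n t = surface f n t := by
    ext x
    exact permIso_mem_surface f t π x
  change MeasurePreserving (permIso π) _ _ at h
  rwa [show ((permIso π).toIsometryEquiv ⁻¹' surface f n t) = surface f n t from h2] at h

lemma measurePreserving_permIso_hLaw (f : ℝ → EReal) (t : ℝ) (π : Equiv.Perm (Fin n)) :
    MeasurePreserving (permIso π) (hLaw f n t) (hLaw f n t) := by
  have hm : Measurable (permIso π) := (permIso π).continuous.measurable
  refine ⟨hm, ?_⟩
  ext s hs
  have h := (measurePreserving_permIso_surfaceVolume f t π).setLIntegral_comp_preimage_emb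
    (permIso π).toHomeomorph.toMeasurableEquiv.measurableEmbedding (hDensity f n t) s
  rw [Measure.map_apply hm hs, hLaw, withDensity_apply _ (hm hs), withDensity_apply _ hs, ← h]
  simp only [hDensity, jacobianA_permIso]

/-- The total mass is `I * I⁻¹` with `I` the normalizing integral, and this is `0` when `I` is `0`
or `∞`. Convergence to a probability law rules out the degenerate case at the end. -/
lemma hLaw_eq_zero_or_isProbabilityMeasure (f : ℝ → EReal) (n : ℕ) (t : ℝ) :
    hLaw f n t = 0 ∨ IsProbabilityMeasure (hLaw f n t) := by
  have hm : Measurable fun s => ENNReal.ofReal (jacobianA f n t s) :=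
    (measurable_jacobianA f n t).ennreal_ofReal
  have hu : hLaw f n t Set.univ = (∫⁻ s, ENNReal.ofReal (jacobianA f n t s) ∂surfaceVolume f n t) *
      (∫⁻ s, ENNReal.ofReal (jacobianA f n t s) ∂surfaceVolume f n t)⁻¹ := by
    rw [hLaw, withDensity_apply _ MeasurableSet.univ, Measure.restrict_univ]
    simp only [hDensity, div_eq_mul_inv]
    rw [lintegral_mul_const _ hm]
  by_cases h0 : ∫⁻ s, ENNReal.ofReal (jacobianA f n t s) ∂surfaceVolume f n t = 0
  · left
    rw [h0, zero_mul] at hu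
    exact Measure.measure_univ_eq_zero.1 hu
  by_cases h1 : ∫⁻ s, ENNReal.ofReal (jacobianA f n t s) ∂surfaceVolume f n t = ∞
  · left
    rw [h1, ENNReal.inv_top, mul_zero] at hu
    exact Measure.measure_univ_eq_zero.1 hu
  · right
    rw [ENNReal.mul_inv_cancel h0 h1] at hu
    exact ⟨hu⟩

lemma ClassF.measurable_R (hf : ClassF f) (n : ℕ) : Measurable (R f n) :=
  Finset.measurable_fun_sum _ fun i _ => hf.measurable.comp (measurable_apply i)

lemma ClassF.ae_hLaw_mem_surface (hf : ClassF f) (n : ℕ) (t : ℝ) :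
    ∀ᵐ x ∂(hLaw f n t), x ∈ surface f n t := by
  have hs : MeasurableSet (surface f n t) := hf.measurable_R n (measurableSet_singleton _)
  exact (withDensity_absolutelyContinuous _ _).ae_le (ae_restrict_mem hs)

lemma toReal_sum_of_ne_top {ι : Type*} (s : Finset ι) {a : ι → EReal} (hb : ∀ i, a i ≠ ⊥)
    (ht : ∑ i ∈ s, a i ≠ ⊤) : (∑ i ∈ s, a i).toReal = ∑ i ∈ s, (a i).toReal := by
  classical
  induction s using Finset.induction_on with
  | empty => simp
  | insert i s hi ih =>
    rw [Finset.sum_insert hi] at ht ⊢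
    have hs := sum_ne_bot s hb
    have h1 : a i ≠ ⊤ := fun h => ht (by rw [h, EReal.top_add_of_ne_bot hs])
    have h2 : ∑ i ∈ s, a i ≠ ⊤ := fun h => ht (by rw [h, EReal.add_top_of_ne_bot (hb i)])
    rw [EReal.toReal_add h1 (hb i) h2 hs, ih h2, Finset.sum_insert hi]

/-- A finite total forces each `f (x i)` to be finite, so `toReal` is additive here. This is the
linear constraint that contradicts independence. -/
lemma ClassF.sum_centered_eq_zero (hf : ClassF f) {t : ℝ} {x : E n} (hx : x ∈ surface f n t) :
    ∑ i, centered f t (x i) = 0 := by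
  have hx' : ∑ i, f (x i) = ((n * t : ℝ) : EReal) := hx
  have h := toReal_sum_of_ne_top Finset.univ (fun i => hf.ne_bot (x i))
    (by rw [hx']; exact EReal.coe_ne_top _)
  rw [hx', EReal.toReal_coe] at h
  simp only [centered, Finset.sum_sub_distrib, ← h]
  simp

/-- Restriction of a vector along an injection of the index sets. -/
noncomputable def pullback (e : Fin k ↪ Fin n) (x : E n) : E k := WithLp.toLp 2 fun i => x (e i)

lemma measurable_toLp_comp (e : Fin k → Fin n) :
    Measurable fun x : E n => (WithLp.toLp 2 fun i => x (e i) : E k) :=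
  (PiLp.volume_preserving_toLp (Fin k)).measurable.comp
    (measurable_pi_lambda _ fun i => measurable_apply (e i))

/-- By exchangeability, every choice of `k` coordinates has the law `p_{n,k,t}`. -/
lemma map_pullback_hLaw (f : ℝ → EReal) (t : ℝ) (hkn : k ≤ n) (e : Fin k ↪ Fin n) :
    (hLaw f n t).map (pullback e) = projLaw f t hkn := by
  -- The matching of the first `k` indices with the chosen ones extends to a permutation of all `n`.
  obtain ⟨σ, hσ⟩ := Equiv.Perm.exists_extending_pair (Fin.castLE hkn) e
    (Fin.castLE_injective hkn) e.injective
  have h : pullback e = proj hkn ∘ permIso σ.symm := by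
    ext x i
    simp [pullback, proj, permIso_apply, hσ]
  have hp : Measurable (proj hkn) := measurable_toLp_comp _
  rw [h, ← Measure.map_map hp (permIso σ.symm).continuous.measurable,
    (measurePreserving_permIso_hLaw f t σ.symm).map_eq, projLaw]

end GibbsSurface

/-! ### Block comparison and separation from the Gibbs law -/

namespace GibbsSurface

open ProbabilityTheory

variable {f : ℝ → EReal} {n k : ℕ}

section Truncation

variable {Ω : Type*} [MeasurableSpace Ω] {μ : Measure Ω} [IsProbabilityMeasure μ] {W : Ω → ℝ}
  {C K : ℝ}

lemma integrable_clamp (hW : Measurable W) (hK : 0 ≤ K) :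
    Integrable (fun ω => clamp K (W ω)) μ :=
  (integrable_const K).mono' ((measurable_clamp K).comp hW).aestronglyMeasurable
    (Eventually.of_forall fun _ => abs_clamp_le hK _)

/-- For a centered variable the truncated mean is minus the mean of the truncation error. -/
lemma abs_integral_clamp_le (hW : Measurable W) (h4 : Integrable (fun ω => W ω ^ 4) μ)
    (h0 : ∫ ω, W ω ∂μ = 0) (hC : ∫ ω, W ω ^ 4 ∂μ ≤ C) (hK : 0 < K) :
    |∫ ω, clamp K (W ω) ∂μ| ≤ C / K ^ 3 := by
  have h1 : Integrable W μ := by simpa using integrable_pow_of_pow_four hW h4 (j := 1) (by norm_num)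
  have h2 : |∫ ω, clamp K (W ω) ∂μ| = |∫ ω, (W ω - clamp K (W ω)) ∂μ| := by
    rw [integral_sub h1 (integrable_clamp hW hK.le), h0, zero_sub, abs_neg]
  rw [h2]
  calc |∫ ω, (W ω - clamp K (W ω)) ∂μ| ≤ ∫ ω, |W ω - clamp K (W ω)| ∂μ :=
        abs_integral_le_integral_abs
    _ ≤ ∫ ω, W ω ^ 4 / K ^ 3 ∂μ := integral_mono (h1.sub (integrable_clamp hW hK.le)).abs
        (h4.div_const _) fun ω => abs_sub_clamp_le hK _
    _ ≤ C / K ^ 3 := by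
        rw [integral_div]
        gcongr

lemma sub_le_integral_clamp_sq (hW : Measurable W) (h4 : Integrable (fun ω => W ω ^ 4) μ)
    (hC : ∫ ω, W ω ^ 4 ∂μ ≤ C) (hK : 0 < K) :
    ∫ ω, W ω ^ 2 ∂μ - C / K ^ 2 ≤ ∫ ω, clamp K (W ω) ^ 2 ∂μ := by
  have h2 := integrable_pow_of_pow_four hW h4 (j := 2) (by norm_num)
  have hc : Integrable (fun ω => clamp K (W ω) ^ 2) μ :=
    h2.mono' (((measurable_clamp K).comp hW).pow_const 2).aestronglyMeasurable
      (Eventually.of_forall fun ω => by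
        rw [Real.norm_eq_abs, abs_of_nonneg (sq_nonneg _)]
        exact sq_le_sq.2 (abs_clamp_le_abs hK.le _))
  calc ∫ ω, W ω ^ 2 ∂μ - C / K ^ 2 ≤ ∫ ω, W ω ^ 2 ∂μ - ∫ ω, W ω ^ 4 / K ^ 2 ∂μ := by
        rw [integral_div]
        gcongr
    _ = ∫ ω, (W ω ^ 2 - W ω ^ 4 / K ^ 2) ∂μ := (integral_sub h2 (h4.div_const _)).symm
    _ ≤ _ := integral_mono (h2.sub (h4.div_const _)) hc fun ω => sq_sub_le_clamp_sq hK _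

lemma measureReal_lt_abs_le (hW : Measurable W) (h4 : Integrable (fun ω => W ω ^ 4) μ)
    (hC : ∫ ω, W ω ^ 4 ∂μ ≤ C) (hK : 0 < K) : μ.real {ω | K < |W ω|} ≤ C / K ^ 4 := by
  have hs : MeasurableSet {ω | K < |W ω|} := measurableSet_lt measurable_const (by fun_prop)
  rw [← integral_indicator_one hs]
  calc ∫ ω, {ω | K < |W ω|}.indicator 1 ω ∂μ ≤ ∫ ω, W ω ^ 4 / K ^ 4 ∂μ := by
        refine integral_mono ((integrable_const (1 : ℝ)).indicator hs) (h4.div_const _) fun ω => ?_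
        by_cases h : ω ∈ {ω | K < |W ω|}
        · rw [Set.indicator_of_mem h, Pi.one_apply, le_div_iff₀ (by positivity), one_mul,
            ← (show Even 4 by decide).pow_abs (W ω)]
          exact pow_le_pow_left₀ hK.le (le_of_lt h) 4
        · rw [Set.indicator_of_notMem h]
          positivity
    _ ≤ C / K ^ 4 := by
        rw [integral_div]
        gcongr

end Truncation

lemma ClassF.measurable_blockSum (hf : ClassF f) (t : ℝ) (A : Finset (Fin n)) :
    Measurable fun x : E n => ∑ i ∈ A, centered f t (x i) :=
  Finset.measurable_fun_sum _ fun i _ => (hf.measurable_centered t).comp (measurable_apply i)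

/-- If `p_{n,k,t}` is close to the Gibbs law, then any two disjoint blocks with at most `k` indices
in total have nearly the joint law of two disjoint blocks under the Gibbs law. -/
lemma ClassF.exists_blocks (hf : ClassF f) {c t : ℝ} (hc : 0 < c) (hkn : k ≤ n)
    [IsProbabilityMeasure (hLaw f n t)] {δ : ℝ}
    (hd : ∀ s, MeasurableSet s → |(projLaw f t hkn).real s - (gibbs f c k).real s| ≤ δ)
    {A B : Finset (Fin n)} (hAB : Disjoint A B) (hcard : A.card + B.card ≤ k) :
    ∃ A' B' : Finset (Fin k), Disjoint A' B' ∧ A'.card = A.card ∧ B'.card = B.card ∧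
      ∀ (ψ : ℝ → ℝ → ℝ) (L : ℝ), Measurable (Function.uncurry ψ) → (∀ a b, |ψ a b| ≤ L) →
        |∫ x, ψ (∑ i ∈ A, centered f t (x i)) (∑ i ∈ B, centered f t (x i)) ∂(hLaw f n t) -
          ∫ y, ψ (∑ i ∈ A', centered f t (y i)) (∑ i ∈ B', centered f t (y i)) ∂(gibbs f c k)| ≤
          2 * L * δ := by
  classical
  -- `A ∪ B` is padded to exactly `k` indices, so that enumerating `U` gives an injection of `Fin k`
  -- whose range contains both blocks.
  obtain ⟨U, hU, hUk⟩ := Finset.exists_superset_card_eq (s := A ∪ B) (n := k)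
    ((Finset.card_union_le A B).trans hcard) (by simpa using hkn)
  set e : Fin k ↪ Fin n := (U.orderEmbOfFin hUk).toEmbedding with he
  have hrange : ∀ i ∈ U, i ∈ Set.range e := fun i hi => by
    have : Set.range (U.orderEmbOfFin hUk) = U := Finset.range_orderEmbOfFin U hUk
    exact this.symm ▸ hi
  have hsum : ∀ (D : Finset (Fin n)), D ⊆ U → ∀ g : Fin n → ℝ,
      ∑ j ∈ D.preimage e e.injective.injOn, g (e j) = ∑ i ∈ D, g i := fun D hD g =>
    Finset.sum_preimage e D e.injective.injOn g fun i hi h => absurd (hrange i (hD hi)) h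
  have hcd : ∀ (D : Finset (Fin n)), D ⊆ U →
      (D.preimage e e.injective.injOn).card = D.card := fun D hD => by
    have := hsum D hD fun _ => 1
    simpa using this
  have hA := Finset.subset_union_left.trans hU
  have hB := Finset.subset_union_right.trans hU
  refine ⟨A.preimage e e.injective.injOn, B.preimage e e.injective.injOn, ?_, hcd A hA, hcd B hB,
    fun ψ L hψ hL => ?_⟩
  · rw [Finset.disjoint_left] at hAB ⊢
    intro j h1 h2
    exact hAB (Finset.mem_preimage.1 h1) (Finset.mem_preimage.1 h2)
  · have hprob := hf.isProbabilityMeasure_gibbs hc k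
    have hpull : Measurable (pullback e) := measurable_toLp_comp e
    have hmap := map_pullback_hLaw f t hkn e
    have hprob' : IsProbabilityMeasure (projLaw f t hkn) := by
      rw [← hmap]
      exact Measure.isProbabilityMeasure_map hpull.aemeasurable
    set Ψ : E k → ℝ := fun y => ψ (∑ i ∈ A.preimage e e.injective.injOn, centered f t (y i))
      (∑ i ∈ B.preimage e e.injective.injOn, centered f t (y i)) with hΨ
    have hΨm : Measurable Ψ :=
      hψ.comp ((hf.measurable_blockSum t _).prodMk (hf.measurable_blockSum t _))
    have h1 : ∫ x, ψ (∑ i ∈ A, centered f t (x i)) (∑ i ∈ B, centered f t (x i)) ∂(hLaw f n t) =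
        ∫ y, Ψ y ∂(projLaw f t hkn) := by
      rw [← hmap, integral_map hpull.aemeasurable hΨm.aestronglyMeasurable]
      refine integral_congr_ae (Eventually.of_forall fun x => ?_)
      simp only [hΨ, pullback]
      rw [hsum A hA fun i => centered f t (x i), hsum B hB fun i => centered f t (x i)]
    rw [h1]
    exact abs_integral_sub_le hd hΨm fun y => hL _ _

/-- Partition of `Fin n` into consecutive blocks of length at most `ℓ`. -/
lemma exists_partition {ℓ M : ℕ} (hℓ : 0 < ℓ) (hℓn : ℓ ≤ n) (hM : n ≤ M * ℓ) :
    ∃ (A : Fin M → Finset (Fin n)) (r₀ : Fin M), (∀ r s, r ≠ s → Disjoint (A r) (A s)) ∧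
      (∀ r, (A r).card ≤ ℓ) ∧ ℓ ≤ (A r₀).card ∧
      ∀ g : Fin n → ℝ, ∑ r, ∑ i ∈ A r, g i = ∑ i, g i := by
  classical
  have hMpos : 0 < M := by
    rcases Nat.eq_zero_or_pos M with rfl | h
    · omega
    · exact h
  have hlt : ∀ i : Fin n, i.val / ℓ < M := fun i => by
    rw [Nat.div_lt_iff_lt_mul hℓ]
    exact i.2.trans_le hM
  -- Block `0` is full because `ℓ ≤ n`; later blocks may be short or empty.
  refine ⟨fun r => Finset.univ.filter fun i => (⟨i.val / ℓ, hlt i⟩ : Fin M) = r, ⟨0, hMpos⟩,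
    fun r s hrs => ?_, fun r => ?_, ?_, fun g => ?_⟩
  · rw [Finset.disjoint_left]
    intro i h1 h2
    simp only [Finset.mem_filter, Finset.mem_univ, true_and] at h1 h2
    exact hrs (h1.symm.trans h2)
  · have h := Finset.card_le_card_of_injOn
      (s := Finset.univ.filter fun i : Fin n => (⟨i.val / ℓ, hlt i⟩ : Fin M) = r)
      (t := Finset.Ico (r.val * ℓ) (r.val * ℓ + ℓ)) Fin.val (fun i hi => by
        simp only [Finset.coe_filter, Finset.mem_univ, true_and, Set.mem_ofPred_eq] at hi
        have hi' : i.val / ℓ = r.val := congrArg Fin.val hi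
        rw [Nat.div_eq_iff hℓ] at hi'
        rw [Finset.mem_coe, Finset.mem_Ico]
        omega) Fin.val_injective.injOn
    simpa using h
  · have h := Finset.card_le_card_of_injOn (s := (Finset.univ : Finset (Fin ℓ)))
      (t := Finset.univ.filter fun i : Fin n => (⟨i.val / ℓ, hlt i⟩ : Fin M) = ⟨0, hMpos⟩)
      (Fin.castLE hℓn) (fun i _ => by simp)
      (Fin.castLE_injective hℓn).injOn
    simpa using h
  · exact Finset.sum_fiberwise _ _ _

/-- Dividing by `√n` makes the fourth moment bounded uniformly in `n`, while a block holding a fixed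
proportion of the indices keeps variance of order one. -/
lemma ClassF.moments_scaled_blockSum (hf : ClassF f) {c t v C : ℝ} (hC : 0 < C)
    {A : Finset (Fin k)} (hAn : A.card ≤ n) (hn : 0 < n)
    (h : Integrable (fun x => (∑ i ∈ A, centered f t (x i)) ^ 4) (gibbs f c k) ∧
      ∫ x, ∑ i ∈ A, centered f t (x i) ∂(gibbs f c k) = 0 ∧
      ∫ x, (∑ i ∈ A, centered f t (x i)) ^ 2 ∂(gibbs f c k) = A.card * v ∧
      ∫ x, (∑ i ∈ A, centered f t (x i)) ^ 4 ∂(gibbs f c k) ≤ C * A.card ^ 2) :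
    Measurable (fun x : E k => (∑ i ∈ A, centered f t (x i)) / √n) ∧
    Integrable (fun x => ((∑ i ∈ A, centered f t (x i)) / √n) ^ 4) (gibbs f c k) ∧
    ∫ x, (∑ i ∈ A, centered f t (x i)) / √n ∂(gibbs f c k) = 0 ∧
    ∫ x, ((∑ i ∈ A, centered f t (x i)) / √n) ^ 2 ∂(gibbs f c k) = A.card * v / n ∧
    ∫ x, ((∑ i ∈ A, centered f t (x i)) / √n) ^ 4 ∂(gibbs f c k) ≤ C := by
  obtain ⟨h4, h1, h2, h4'⟩ := h
  have hn' : (0 : ℝ) < n := by exact_mod_cast hn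
  have hs2 : √(n : ℝ) ^ 2 = n := Real.sq_sqrt hn'.le
  have hs4 : √(n : ℝ) ^ 4 = (n : ℝ) ^ 2 := by
    rw [show √(n : ℝ) ^ 4 = (√(n : ℝ) ^ 2) ^ 2 by ring, hs2]
  refine ⟨(hf.measurable_blockSum t A).div_const _, ?_, ?_, ?_, ?_⟩
  · simp only [div_pow]
    exact h4.div_const _
  · rw [integral_div, h1, zero_div]
  · simp only [div_pow]
    rw [integral_div, h2, hs2]
  · simp only [div_pow]
    rw [integral_div, hs4, div_le_iff₀ (by positivity)]
    refine h4'.trans ?_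
    gcongr

/-- The main estimate: closeness of `p_{n,k,t}` to the Gibbs law bounds the block variance. -/
lemma ClassF.block_variance_le (hf : ClassF f) {c t v C : ℝ} (hc : 0 < c) (hC : 0 < C)
    (hmom : ∀ (k : ℕ) (A : Finset (Fin k)),
      Integrable (fun x => (∑ i ∈ A, centered f t (x i)) ^ 4) (gibbs f c k) ∧
      ∫ x, ∑ i ∈ A, centered f t (x i) ∂(gibbs f c k) = 0 ∧
      ∫ x, (∑ i ∈ A, centered f t (x i)) ^ 2 ∂(gibbs f c k) = A.card * v ∧
      ∫ x, (∑ i ∈ A, centered f t (x i)) ^ 4 ∂(gibbs f c k) ≤ C * A.card ^ 2) (hv : 0 < v)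
    (hkn : k ≤ n) [IsProbabilityMeasure (hLaw f n t)] {δ : ℝ}
    (hd : ∀ s, MeasurableSet s → |(projLaw f t hkn).real s - (gibbs f c k).real s| ≤ δ)
    {ℓ M : ℕ} (hℓ : 0 < ℓ) (hℓk : 2 * ℓ ≤ k) (hM : n ≤ M * ℓ) {K : ℝ} (hK : 0 < K) :
    ℓ * v / n ≤ C / K ^ 2 + 2 * K ^ 2 * δ + (M * ((C / K ^ 3) ^ 2 + 2 * K ^ 2 * δ) +
      M ^ 2 * K ^ 2 * (C / K ^ 4 + 2 * δ)) := by
  have hn : 0 < n := by omega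
  have hn' : (0 : ℝ) < n := by exact_mod_cast hn
  have hδ : 0 ≤ δ := (abs_nonneg _).trans (hd ∅ MeasurableSet.empty)
  have hprob := hf.isProbabilityMeasure_gibbs hc k
  obtain ⟨A, r₀, hdisj, hcard, hcard₀, hsum⟩ := exists_partition hℓ (by omega : ℓ ≤ n) hM
  set B : Fin M → E n → ℝ := fun r x => (∑ i ∈ A r, centered f t (x i)) / √n with hBdef
  have hBm : ∀ r, Measurable (B r) := fun r => (hf.measurable_blockSum t (A r)).div_const _
  have hB0 : ∀ᵐ x ∂(hLaw f n t), ∑ r, B r x = 0 := by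
    filter_upwards [hf.ae_hLaw_mem_surface n t] with x hx
    simp only [hBdef]
    rw [← Finset.sum_div, hsum fun i => centered f t (x i), hf.sum_centered_eq_zero hx, zero_div]
  have hscale : Measurable fun a : ℝ => clamp K (a / √n) :=
    (measurable_clamp K).comp (measurable_id.div_const _)
  have hclamp : ∀ a : ℝ, |clamp K a| ≤ K := abs_clamp_le hK.le
  have htail : ∀ r, (hLaw f n t).real {x | K < |B r x|} ≤ C / K ^ 4 + 2 * δ := fun r => by
    -- Pairing with the empty block gives the comparison for a single block.
    obtain ⟨A', B', -, hA', -, hψ⟩ := hf.exists_blocks hc hkn hd (A := A r) (B := ∅)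
      (Finset.disjoint_empty_right _) (by have := hcard r; simp; omega)
    obtain ⟨m1, m2, m3, m4, m5⟩ := hf.moments_scaled_blockSum (n := n) hC
      (by have := hcard r; omega) hn (hmom k A')
    have hset : MeasurableSet {a : ℝ | K < |a / √n|} :=
      measurableSet_lt measurable_const (by fun_prop)
    have h := hψ (fun a _ => {a : ℝ | K < |a / √n|}.indicator 1 a) 1
      ((measurable_one.indicator hset).comp measurable_fst) fun a _ => by
        by_cases ha : a ∈ {a : ℝ | K < |a / √n|} <;> simp [ha]
    have e1 : ∫ x, {a : ℝ | K < |a / √n|}.indicator 1 (∑ i ∈ A r, centered f t (x i))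
        ∂(hLaw f n t) = (hLaw f n t).real {x | K < |B r x|} :=
      integral_indicator_one ((hf.measurable_blockSum t (A r)) hset)
    have e2 : ∫ y, {a : ℝ | K < |a / √n|}.indicator 1 (∑ i ∈ A', centered f t (y i))
        ∂(gibbs f c k) =
        (gibbs f c k).real {y | K < |(∑ i ∈ A', centered f t (y i)) / √n|} :=
      integral_indicator_one ((hf.measurable_blockSum t A') hset)
    simp only [e1, e2] at h
    have h2 := measureReal_lt_abs_le m1 m2 m5 hK
    linarith [(abs_le.1 h).2]
  -- Two blocks use at most `2ℓ ≤ k` indices. Under the Gibbs law their truncated covariance is a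
  -- product of two truncated means, each at most `C / K ^ 3`.
  have hcross : ∀ r, r ≠ r₀ → |∫ x, clamp K (B r₀ x) * clamp K (B r x) ∂(hLaw f n t)| ≤
      (C / K ^ 3) ^ 2 + 2 * K ^ 2 * δ := fun r hr => by
    obtain ⟨A', B', hAB', hA', hB', hψ⟩ := hf.exists_blocks hc hkn hd (hdisj r₀ r hr.symm)
      (by have := hcard r; have := hcard r₀; omega)
    obtain ⟨a1, a2, a3, a4, a5⟩ := hf.moments_scaled_blockSum (n := n) hC
      (by have := hcard r₀; omega) hn (hmom k A')
    obtain ⟨b1, b2, b3, b4, b5⟩ := hf.moments_scaled_blockSum (n := n) hC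
      (by have := hcard r; omega) hn (hmom k B')
    have h := hψ (fun a b => clamp K (a / √n) * clamp K (b / √n)) (K ^ 2)
      ((hscale.comp measurable_fst).mul (hscale.comp measurable_snd)) fun a b => by
        rw [abs_mul, sq]
        exact mul_le_mul (hclamp _) (hclamp _) (abs_nonneg _) hK.le
    have hind : IndepFun (fun y : E k => clamp K ((∑ i ∈ A', centered f t (y i)) / √n))
        (fun y => clamp K ((∑ i ∈ B', centered f t (y i)) / √n)) (gibbs f c k) :=
      (indepFun_sum_of_disjoint (fun i => (hf.measurable_centered t).comp (measurable_apply i))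
        (hf.iIndepFun_centered_gibbs hc t k) hAB').comp hscale hscale
    rw [hind.integral_fun_mul_eq_mul_integral
      ((measurable_clamp K).comp a1).aestronglyMeasurable
      ((measurable_clamp K).comp b1).aestronglyMeasurable] at h
    have hp : |(∫ y : E k, clamp K ((∑ i ∈ A', centered f t (y i)) / √n) ∂(gibbs f c k)) *
        ∫ y : E k, clamp K ((∑ i ∈ B', centered f t (y i)) / √n) ∂(gibbs f c k)| ≤
        (C / K ^ 3) ^ 2 := by
      rw [abs_mul, sq]
      exact mul_le_mul (abs_integral_clamp_le a1 a2 a3 a5 hK) (abs_integral_clamp_le b1 b2 b3 b5 hK)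
        (abs_nonneg _) (by positivity)
    have := abs_sub_abs_le_abs_sub
      (∫ x, clamp K (B r₀ x) * clamp K (B r x) ∂(hLaw f n t))
      ((∫ y : E k, clamp K ((∑ i ∈ A', centered f t (y i)) / √n) ∂(gibbs f c k)) *
        ∫ y : E k, clamp K ((∑ i ∈ B', centered f t (y i)) / √n) ∂(gibbs f c k))
    linarith
  -- The constraint bounds the truncated second moment above; below, it is compared with the Gibbs
  -- value at cost `2 * K ^ 2 * δ`.
  have hmain := integral_clamp_sq_le hBm hB0 hK.le r₀ htail (by positivity) hcross
  obtain ⟨A', B', -, hA', -, hψ⟩ := hf.exists_blocks hc hkn hd (A := A r₀) (B := ∅)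
    (Finset.disjoint_empty_right _) (by have := hcard r₀; simp; omega)
  obtain ⟨m1, m2, m3, m4, m5⟩ := hf.moments_scaled_blockSum (n := n) hC
    (by have := hcard r₀; omega) hn (hmom k A')
  have h := hψ (fun a _ => clamp K (a / √n) ^ 2) (K ^ 2)
    ((hscale.comp measurable_fst).pow_const 2) fun a _ => by
      rw [abs_pow]
      exact pow_le_pow_left₀ (abs_nonneg _) (hclamp _) 2
  have h2 := sub_le_integral_clamp_sq m1 m2 m5 hK
  have h3 : ℓ * v / n ≤ A'.card * v / n := by
    rw [hA']
    gcongr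
  rw [m4] at h2
  rw [Fintype.card_fin] at hmain
  have h4 := (abs_le.1 h).1
  change -(2 * K ^ 2 * δ) ≤ ∫ x, clamp K (B r₀ x) ^ 2 ∂(hLaw f n t) - _ at h4
  linarith

/-- If `k ≥ ε n`, then `p_{n,k,t}` stays away from the Gibbs law. -/
lemma ClassF.exists_separation (hf : ClassF f) {c t : ℝ} (hc : 0 < c)
    (hct : energy f 1 (gibbsDensity f c 1) = t) {ε : ℝ} (hε : 0 < ε) :
    ∃ δ : ℝ, 0 < δ ∧ δ < 1 ∧ ∃ N : ℕ, ∀ (n k : ℕ) (hkn : k ≤ n), N ≤ n → ε * n ≤ k →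
      IsProbabilityMeasure (hLaw f n t) →
      ¬ ∀ s, MeasurableSet s → |(projLaw f t hkn).real s - (gibbs f c k).real s| ≤ δ := by
  obtain ⟨v, C, hv, hC, hmom⟩ := hf.exists_moment_bounds hc hct
  -- Blocks of length `k / 2 ≥ εn / 4` cover all indices once `M ≥ 4 / ε`; `n ≥ 2 / ε` takes care of
  -- the rounding in `k / 2`.
  obtain ⟨M, hM⟩ := exists_nat_ge (4 / ε)
  obtain ⟨N, hN⟩ := exists_nat_ge (2 / ε)
  rw [div_le_iff₀ hε] at hM hN
  have hM0 : (0 : ℝ) < M := by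
    by_contra h
    nlinarith
  -- For `K ≥ 1` the right side of `block_variance_le` is at most `D / K ^ 2 + F * δ`. First `K`,
  -- then `δ`, is chosen to make each term at most `εv / 16`, whereas the left side is at least `εv
  -- / 4`.
  set D : ℝ := C + M * C ^ 2 + M ^ 2 * C with hD
  have hD0 : 0 < D := by positivity
  set K : ℝ := √(1 + 16 * D / (ε * v)) with hKdef
  have hK2 : K ^ 2 = 1 + 16 * D / (ε * v) := Real.sq_sqrt (by positivity)
  have hK1 : 1 ≤ K := Real.one_le_sqrt.2 (by
    have : 0 < 16 * D / (ε * v) := by positivity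
    linarith)
  have hK0 : 0 < K := one_pos.trans_le hK1
  set F : ℝ := (2 + 2 * M + 2 * M ^ 2) * K ^ 2 with hF
  have hF0 : 0 < F := by positivity
  refine ⟨min (1 / 2) (ε * v / (16 * F)), by positivity,
    (min_le_left _ _).trans_lt (by norm_num), N + 1, fun n k hkn hNn hεk hprob hd => ?_⟩
  set δ : ℝ := min (1 / 2) (ε * v / (16 * F)) with hδ
  have hn' : (N : ℝ) + 1 ≤ n := by exact_mod_cast hNn
  have hn0 : (0 : ℝ) < n := by
    have : (0 : ℝ) ≤ N := N.cast_nonneg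
    linarith
  have hεn : 2 ≤ ε * n := by nlinarith
  have hℓ : ε * n / 4 ≤ ((k / 2 : ℕ) : ℝ) := by
    have h1 : (k : ℝ) ≤ 2 * ((k / 2 : ℕ) : ℝ) + 1 := by
      exact_mod_cast (by omega : k ≤ 2 * (k / 2) + 1)
    linarith
  have hℓ0 : 0 < k / 2 := by
    have : (0 : ℝ) < ((k / 2 : ℕ) : ℝ) := lt_of_lt_of_le (by positivity) hℓ
    exact_mod_cast this
  have hnM : n ≤ M * (k / 2) := by
    have h1 : (n : ℝ) ≤ M * ((k / 2 : ℕ) : ℝ) := by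
      have h2 : (M : ℝ) * (ε * n / 4) ≤ M * ((k / 2 : ℕ) : ℝ) := by gcongr
      nlinarith
    exact_mod_cast h1
  have key := hf.block_variance_le hc hC hmom hv hkn hd hℓ0 (by omega) hnM hK0
  have hlow : ε * v / 4 ≤ ((k / 2 : ℕ) : ℝ) * v / n := by
    rw [le_div_iff₀ hn0]
    nlinarith
  have hD' : D / K ^ 2 ≤ ε * v / 16 := by
    rw [div_le_iff₀ (by positivity), hK2]
    have h1 : ε * v / 16 * (1 + 16 * D / (ε * v)) = ε * v / 16 + D := by field_simp
    rw [h1]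
    have : 0 < ε * v := by positivity
    linarith
  have hF' : F * δ ≤ ε * v / 16 := by
    calc F * δ ≤ F * (ε * v / (16 * F)) := by gcongr; exact min_le_right _ _
      _ = ε * v / 16 := by field_simp
  have h6 : (C / K ^ 3) ^ 2 ≤ C ^ 2 / K ^ 2 := by
    rw [div_pow, ← pow_mul]
    gcongr
    norm_num
  have h4 : K ^ 2 * (C / K ^ 4) = C / K ^ 2 := by field_simp
  have hup : C / K ^ 2 + 2 * K ^ 2 * δ + (M * ((C / K ^ 3) ^ 2 + 2 * K ^ 2 * δ) +
      M ^ 2 * K ^ 2 * (C / K ^ 4 + 2 * δ)) ≤ D / K ^ 2 + F * δ := by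
    calc C / K ^ 2 + 2 * K ^ 2 * δ + (M * ((C / K ^ 3) ^ 2 + 2 * K ^ 2 * δ) +
          M ^ 2 * K ^ 2 * (C / K ^ 4 + 2 * δ))
        = C / K ^ 2 + M * (C / K ^ 3) ^ 2 + M ^ 2 * (K ^ 2 * (C / K ^ 4)) + F * δ := by
          rw [hF]
          ring
      _ ≤ C / K ^ 2 + M * (C ^ 2 / K ^ 2) + M ^ 2 * (C / K ^ 2) + F * δ := by
          rw [h4]
          gcongr
      _ = D / K ^ 2 + F * δ := by
          rw [hD]
          ring
  have : 0 < ε * v := by positivity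
  linarith

/-! ### Passage to total variation and relative entropy -/

lemma abs_measureReal_sub_le_of_tvDist_le {Ω : Type*} [MeasurableSpace Ω] {μ ν : Measure Ω} {δ : ℝ}
    (hδ : 0 ≤ δ) (h : tvDist μ ν ≤ ENNReal.ofReal δ) {s : Set Ω} (hs : MeasurableSet s) :
    |μ.real s - ν.real s| ≤ δ := by
  have h1 : ENNReal.ofReal |μ.real s - ν.real s| ≤ tvDist μ ν := by
    rw [tvDist, two_mul]
    exact (le_iSup₂ (f := fun (s : Set Ω) (_ : MeasurableSet s) =>
      ENNReal.ofReal |μ.real s - ν.real s|) s hs).trans le_self_add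
  exact (ENNReal.ofReal_le_ofReal_iff hδ).1 (h1.trans h)

lemma projLaw_eq_zero_or_isProbabilityMeasure (f : ℝ → EReal) (t : ℝ) (hkn : k ≤ n) :
    projLaw f t hkn = 0 ∨
      IsProbabilityMeasure (hLaw f n t) ∧ IsProbabilityMeasure (projLaw f t hkn) := by
  have hp : Measurable (proj hkn) := measurable_toLp_comp _
  rcases hLaw_eq_zero_or_isProbabilityMeasure f n t with h | h
  · left
    rw [projLaw, h, Measure.map_zero]
  · exact Or.inr ⟨h, Measure.isProbabilityMeasure_map hp.aemeasurable⟩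

lemma tendsto_div_zero_of_eventually {n k : ℕ → ℕ}
    (h : ∀ ε : ℝ, 0 < ε → ∀ᶠ j in atTop, 0 < n j ∧ ¬ ε * n j ≤ k j) :
    Tendsto (fun j => (k j : ℝ) / (n j : ℝ)) atTop (𝓝 0) := by
  rw [tendsto_order]
  refine ⟨fun a ha => Eventually.of_forall fun j => ha.trans_le (by positivity), fun ε hε => ?_⟩
  filter_upwards [h ε hε] with j hj
  have hn : (0 : ℝ) < n j := by exact_mod_cast hj.1
  rw [div_lt_iff₀ hn]
  exact not_le.1 hj.2

end GibbsSurface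

theorem proposition4p1 (f : ℝ → EReal) (hf : GibbsSurface.ClassF f)
    (t c : ℝ) (ht : 0 < t) (hc : 0 < c)
    (hct : GibbsSurface.energy f 1 (GibbsSurface.gibbsDensity f c 1) = t)
    (n k : ℕ → ℕ) (hn : Tendsto n atTop atTop) (hkn : ∀ j, k j ≤ n j) :
    (Tendsto
        (fun j => GibbsSurface.tvDist (GibbsSurface.projLaw f t (hkn j))
          (GibbsSurface.gibbs f c (k j))) atTop (𝓝 0) →
      Tendsto (fun j => (k j : ℝ) / (n j : ℝ)) atTop (𝓝 0)) ∧
    (Tendsto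
        (fun j => InformationTheory.klDiv (GibbsSurface.projLaw f t (hkn j))
          (GibbsSurface.gibbs f c (k j))) atTop (𝓝 0) →
      Tendsto (fun j => (k j : ℝ) / (n j : ℝ)) atTop (𝓝 0)) := by
  have hprob := hf.isProbabilityMeasure_gibbs hc
  constructor
  · intro htv
    refine GibbsSurface.tendsto_div_zero_of_eventually fun ε hε => ?_
    obtain ⟨δ, hδ, hδ1, N, hsep⟩ := hf.exists_separation hc hct hε
    filter_upwards [hn.eventually_ge_atTop (N + 1),
      htv.eventually_le_const (ENNReal.ofReal_pos.2 hδ)] with j hj hle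
    refine ⟨by omega, fun hεk => ?_⟩
    have hd := fun s hs =>
      GibbsSurface.abs_measureReal_sub_le_of_tvDist_le hδ.le hle (s := s) hs
    rcases GibbsSurface.projLaw_eq_zero_or_isProbabilityMeasure f t (hkn j) with h0 | ⟨h1, -⟩
    -- The zero measure differs from the Gibbs law by `1 > δ` on the whole space.
    · have := hd Set.univ MeasurableSet.univ
      rw [h0] at this
      simp at this
      linarith
    · exact hsep _ _ (hkn j) (by omega) hεk h1 hd
  · intro hkl
    refine GibbsSurface.tendsto_div_zero_of_eventually fun ε hε => ?_
    obtain ⟨δ, hδ, hδ1, N, hsep⟩ := hf.exists_separation hc hct hε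
    -- Weak Pinsker with parameter `δ / 2` then yields `δ / 2 + δ / 2`.
    set δ' : ℝ := δ / 2 / (1 + (δ / 2)⁻¹) with hδ'
    have hδ'0 : 0 < δ' := by positivity
    have hδ'1 : (1 + (δ / 2)⁻¹) * δ' = δ / 2 := by
      rw [hδ']
      field_simp
    filter_upwards [hn.eventually_ge_atTop (N + 1),
      hkl.eventually_lt_const (ENNReal.ofReal_pos.2 hδ'0),
      hkl.eventually_lt_const one_pos] with j hj hle hle1
    refine ⟨by omega, fun hεk => ?_⟩
    rcases GibbsSurface.projLaw_eq_zero_or_isProbabilityMeasure f t (hkn j) with h0 | ⟨h1, h2⟩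
    -- The divergence of the zero measure from a probability measure is `1`, hence the extra
    -- threshold `hle1`.
    · rw [h0, InformationTheory.klDiv_zero_left, measure_univ] at hle1
      exact lt_irrefl _ hle1
    · refine hsep _ _ (hkn j) (by omega) hεk h1 fun s _ => ?_
      have hne := (hle.trans ENNReal.ofReal_lt_top).ne
      refine (GibbsSurface.abs_measureReal_sub_le_klDiv (half_pos hδ) hne s).trans ?_
      have h3 := ENNReal.toReal_le_of_le_ofReal hδ'0.le hle.le
      have h4 : (1 + (δ / 2)⁻¹) * (InformationTheory.klDiv (GibbsSurface.projLaw f t (hkn j))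
          (GibbsSurface.gibbs f c (k j))).toReal ≤ (1 + (δ / 2)⁻¹) * δ' := by gcongr
      linarith
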